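/- **Model.** Let $T,d\ge 1$ and $X_t=f_t+\Sigma\epsilon_t\in\mathbb R^d$, $t=1,\dots,T$, where $\epsilon_1,\dots,\epsilon_T$ are i.i.d. $d$-variate standard normal and $\Sigma$ is diagonal with entries $\sigma_1,\dots,\sigma_d$, $|\sigma_q|\le\bar\sigma$. The deterministic signal is continuous and piecewise linear with $N\ge 0$ change-points $0=r_0<r_1<\dots<r_N<r_{N+1}=T$: there are vectors $\mu_{1,k},\mu_{2,k}\in\mathbb R^d$ with $f_t=\mu_{1,k}+\mu_{2,k}t$ for $r_{k-1}<t\le r_k$, $k=1,\dots,N+1$, with $\mu_{1,j}+\mu_{2,j}r_j=\mu_{1,j+1}+\mu_{2,j+1}r_j$ and $f_{r_j-1}+f_{r_j+1}\ne 2f_{r_j}$ for $j=1,\dots,N$. Write $$\delta_T=\min_{1\le j\le N+1}(r_j-r_{j-1}),\qquad \Delta_j^q=|f_{r_j-1,q}+f_{r_j+1,q}-2f_{r_j,q}|,\qquad \underline f_T=\inf_{1\le j\le N}\ \sup_{1\le q\le d}\Delta_j^q$$ ($\underline f_T=\infty$ if $N=0$). **Contrast.** For $1\le s<b<e\le T$,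 $n=e-s+1$, put $C_{s,e}^b(x)=\bigl|\sum_{t=s}^e x_t\phi_{s,e}^b(t)\bigr|$, where $$\phi_{s,e}^b(t)=\begin{cases}\alpha\beta\,[(e+2b-3s+2)t-(be+bs-2s^2+2s)],& s\le t\le b,\\ (\alpha/\beta)\,[(2e^2+2e-be-bs)-(3e-2b-s+2)t],& b<t\le e,\end{cases}$$ $$\alpha=\sqrt{\tfrac{6}{n(n^2-1)(1+(e-b+1)(b-s+1)+(e-b)(b-s))}},\qquad \beta=\sqrt{\tfrac{(e-b+1)(e-b)}{(b-s+1)(b-s)}},$$ and $G_{s,e}^b=\max_{1\le q\le d}C_{s,e}^b(X_{\cdot,q})$. **Algorithm (MID with the $L_\infty$ norm, integer expansion step $\lambda_T\ge 1$, threshold $\zeta_{T,d}$).** Start with $[s,e]=[1,T]$. Given $[s,e]$, test in turn the intervals $R_1,L_1,R_2,L_2,\dots$, where $R_k=[s,c]$ with $c$ the $k$-th multiple of $\lambda_T$ larger than $s$ (cut off at $e$), and $L_k=[c,e]$ with $c$ the $k$-th of the points $T-i\lambda_T+1$, $i=1,2,\dots$, smaller than $e$ (cut off at $s$), until both have reached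 $[s,e]$. For an interval $[a,c]$ let $\hat b$ be the (first) maximiser of $G_{a,c}^b$ over $a<b<c$; if $G_{a,c}^{\hat b}>\zeta_{T,d}$, then $\hat b$ is declared a change-point, and the search restarts in $[c,e]$ if $[a,c]$ was right-expanding and in $[s,a]$ if it was left-expanding. If no interval gives a detection, stop. Let $\hat N$ be the number of detections, $\hat r_1<\dots<\hat r_{\hat N}$ their locations, $[s_j,e_j]$ the interval in which $\hat r_j$ is detected, and $q_j\in\operatorname{argmax}_{1\le k\le d}C_{s_j,e_j}^{\hat r_j}(X_{\cdot,k})$. **Theorem.** For all $\bar\sigma>0$ and $m>1$ there are positive constants $\underline C^*,C_1,C_2,C_3,C_4$ with $C_1<C_2\,\underline C^*$, depending only on $\bar\sigma$ and $m$ (in particular not on $T$ or $d$), such that the following holds for every model as above. If $\lambda_T\le\delta_T/m$, $$\text{(A2)}\qquad \delta_T^{3/2}\,\underline f_T\ \ge\ \underline C^*\sqrt{\log(Td^{1/4})},$$ and $C_1\sqrt{\log(Td^{1/4})}\le\zeta_{T,d}<C_2\,\delta_T^{3/2}\underline f_T$, then $$\mathbb P\Bigl(\hat N=N,\ \ \max_{1\le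 j\le N}|\hat r_j-r_j|\,(\Delta_j^{q_j})^{2/3}\le C_3\,(\log(Td^{1/4}))^{1/3}\Bigr)\ \ge\ 1-\frac{C_4}{T}.$$ -/

import Mathlib

open MeasureTheory ProbabilityTheory
open scoped ENNReal

namespace MID

noncomputable section

/-! ### The signal -/

/-- A `d`-variate signal `f t q` at times `t = 1, …, T` (values at other times are irrelevant) that
is continuous and piecewise linear with exactly the `N` change-points `r 1 < ⋯ < r N`, where
`r 0 = 0` and `r (N + 1) = T`. A change-point need not be present in every component. -/
structure IsPiecewiseLinearSignal (T d N : ℕ) (r : ℕ → ℕ) (f : ℕ → Fin d → ℝ) : Prop where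
  zero : r 0 = 0
  last : r (N + 1) = T
  increasing : ∀ k ≤ N, r k < r (k + 1)
  linear : ∃ μ₁ μ₂ : ℕ → Fin d → ℝ,
    (∀ k ∈ Finset.Icc 1 (N + 1), ∀ t ∈ Finset.Icc (r (k - 1) + 1) (r k),
      ∀ q, f t q = μ₁ k q + μ₂ k q * t) ∧
    (∀ j ∈ Finset.Icc 1 N, ∀ q,
      μ₁ j q + μ₂ j q * r j = μ₁ (j + 1) q + μ₂ (j + 1) q * r j)
  change : ∀ j ∈ Finset.Icc 1 N, ∃ q, f (r j - 1) q + f (r j + 1) q ≠ 2 * f (r j) q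

/-- `δ_T`, the minimum of `r j - r (j - 1)` over `j = 1, …, N + 1`. -/
def minSpacing (N : ℕ) (r : ℕ → ℕ) : ℕ :=
  (Finset.range (N + 1)).inf' Finset.nonempty_range_add_one fun j => r (j + 1) - r j

/-- The magnitude `|f_{t-1,q} + f_{t+1,q} - 2 f_{t,q}|` of the change of slope of component `q`
at time `t`; for `t = r j` this is `Δ_j^q`. -/
def slopeChange {d : ℕ} (f : ℕ → Fin d → ℝ) (t : ℕ) (q : Fin d) : ℝ :=
  |f (t - 1) q + f (t + 1) q - 2 * f t q|

/-- The minimum magnitude of the changes, `inf_{j=1,…,N} sup_{q=1,…,d} Δ_j^q`, taken in `[0, ∞]`,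
so that it is `∞` when there is no change-point. -/
def minMagnitude {d : ℕ} (N : ℕ) (r : ℕ → ℕ) (f : ℕ → Fin d → ℝ) : ℝ≥0∞ :=
  ⨅ j ∈ Finset.Icc 1 N, ⨆ q : Fin d, ENNReal.ofReal (slopeChange f (r j) q)

/-- `δ_T ^ (3/2)` times the minimum magnitude of the changes. -/
def signalStrength {d : ℕ} (N : ℕ) (r : ℕ → ℕ) (f : ℕ → Fin d → ℝ) : ℝ≥0∞ :=
  (minSpacing N r : ℝ≥0∞) ^ (3 / 2 : ℝ) * minMagnitude N r f

/-- The logarithmic factor `log (T d^{1/4})`. -/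
def logTd (T d : ℕ) : ℝ := Real.log (T * (d : ℝ) ^ (1 / 4 : ℝ))

/-! ### The data -/

/-- One realisation of `X_t = f_t + Σ ε_t`, where `Σ` is the diagonal matrix with diagonal `σ`. -/
def observe {d : ℕ} (f : ℕ → Fin d → ℝ) (σ : Fin d → ℝ)
    (noise : ℕ → EuclideanSpace ℝ (Fin d)) (t : ℕ) (q : Fin d) : ℝ :=
  f t q + σ q * noise t q

/-! ### The contrast function for changes of slope -/

/-- The normalising factor `α_{s,e}^b`. -/
def contrastAlpha (s e b : ℝ) : ℝ :=
  Real.sqrt (6 / ((e - s + 1) * ((e - s + 1) ^ 2 - 1) *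
    (1 + (e - b + 1) * (b - s + 1) + (e - b) * (b - s))))

/-- The balancing factor `β_{s,e}^b`. -/
def contrastBeta (s e b : ℝ) : ℝ :=
  Real.sqrt ((e - b + 1) * (e - b) / ((b - s + 1) * (b - s)))

/-- The contrast vector `φ_{s,e}^b(t)`; it is only used for `s < b < e`. -/
def contrastVec (s e b t : ℕ) : ℝ :=
  if s ≤ t ∧ t ≤ b then
    contrastAlpha s e b * contrastBeta s e b *
      (((e : ℝ) + 2 * b - 3 * s + 2) * t - ((b : ℝ) * e + b * s - 2 * s ^ 2 + 2 * s))
  else if b + 1 ≤ t ∧ t ≤ e then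
    contrastAlpha s e b / contrastBeta s e b *
      ((2 * (e : ℝ) ^ 2 + 2 * e - b * e - b * s) - (3 * (e : ℝ) - 2 * b - s + 2) * t)
  else 0

/-- The contrast function `C_{s,e}^b(x) = |⟨x, φ_{s,e}^b⟩|` of a univariate sequence `x`; the vector
`φ_{s,e}^b` vanishes outside `[s, e]`. -/
def contrast (s e b : ℕ) (x : ℕ → ℝ) : ℝ :=
  |∑ t ∈ Finset.Icc s e, x t * contrastVec s e b t|

/-- The contrast values of the `d` component sequences aggregated with the `L_∞` norm. -/
def aggContrast {d : ℕ} (X : ℕ → Fin d → ℝ) (s e b : ℕ) : ℝ :=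
  ⨆ q : Fin d, contrast s e b fun t => X t q

/-! ### The algorithm -/

/-- A detected change-point `loc` together with the interval `[left, right]` it was detected in. -/
structure Detection where
  loc : ℕ
  left : ℕ
  right : ℕ

/-- The side towards which an interval expands. -/
inductive Side
  | right
  | left

/-- Test the interval `[a, c]`: the candidates are `a + 1, …, c - 1`. The (first) candidate with the
largest aggregated contrast is returned if its value exceeds the threshold `ζ`. -/
def testInterval {d : ℕ} (X : ℕ → Fin d → ℝ) (ζ : ℝ) (a c : ℕ) : Option ℕ :=
  open Classical in
  ((List.range' (a + 1) (c - a - 1)).argmax (aggContrast X a c)).filter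
    fun b => decide (ζ < aggContrast X a c b)

/-- The `k`-th (`k = 1, 2, …`) right endpoint of the right-expanding intervals starting at `s`
inside `[s, e]`: the `k`-th multiple of the expansion step `lam` that is larger than `s`, cut off
at `e`. -/
def rightEnd (lam s e k : ℕ) : ℕ := min ((s / lam + k) * lam) e

/-- The `k`-th (`k = 1, 2, …`) left endpoint of the left-expanding intervals ending at `e` inside
`[s, e]`: the `k`-th of the points `T - i * lam + 1` that are smaller than `e`, cut off at `s`. -/
def leftStart (T lam s e k : ℕ) : ℕ := max (T + 1 - ((T + 1 - e) / lam + k) * lam) s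

/-- The ordered intervals `R_1, L_1, R_2, L_2, …` inside `[s, e]`, up to `R_K, L_K` with
`K = ⌈T / lam⌉`, by which both sequences have reached `[s, e]`. -/
def expandingIntervals (T lam s e : ℕ) : List (Side × ℕ × ℕ) :=
  (List.range ⌈(T : ℝ) / lam⌉₊).flatMap fun i =>
    [(Side.right, s, rightEnd lam s e (i + 1)), (Side.left, leftStart T lam s e (i + 1), e)]

/-- The first detection when the expanding intervals inside `[s, e]` are tested in their order. -/
def firstDetection {d : ℕ} (X : ℕ → Fin d → ℝ) (T lam : ℕ) (ζ : ℝ) (s e : ℕ) :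
    Option (Side × Detection) :=
  (expandingIntervals T lam s e).findSome? fun I =>
    (testInterval X ζ I.2.1 I.2.2).map fun b => (I.1, ⟨b, I.2.1, I.2.2⟩)

/-- The detections made inside `[s, e]`, in increasing order of location. After a detection in a
right-expanding interval `[s, c]` the search restarts in `[c, e]`; after a detection in a
left-expanding interval `[c, e]` it restarts in `[s, c]`. The first argument bounds the number of
restarts. Since `s < loc < c`, respectively `c < loc < e`, the list stays sorted. -/
def midAux {d : ℕ} (X : ℕ → Fin d → ℝ) (T lam : ℕ) (ζ : ℝ) : ℕ → ℕ → ℕ → List Detection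
  | 0, _, _ => []
  | n + 1, s, e =>
    match firstDetection X T lam ζ s e with
    | none => []
    | some (Side.right, D) => D :: midAux X T lam ζ n D.right e
    | some (Side.left, D) => midAux X T lam ζ n s D.left ++ [D]

/-- Multivariate Isolate-Detect on `X_1, …, X_T` with expansion step `lam` and threshold `ζ`. Every
detection shortens the interval that is searched, so that `T` is more than the number of restarts
that can occur. The length of the list is the estimated number of change-points, and the locations
in it are the estimated change-points in increasing order. -/
def mid {d : ℕ} (X : ℕ → Fin d → ℝ) (T lam : ℕ) (ζ : ℝ) : List Detection :=
  midAux X T lam ζ T 1 T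

/-- The component `q` maximises the contrast function at the detection `D`, over the interval in
which `D` was made. -/
def IsMaxComponent {d : ℕ} (X : ℕ → Fin d → ℝ) (D : Detection) (q : Fin d) : Prop :=
  ∀ k : Fin d, contrast D.left D.right D.loc (fun t => X t k) ≤
    contrast D.left D.right D.loc (fun t => X t q)

/-- The detections `Ds` are as many as the change-points, and the `j`-th one `r̂_j` satisfies
`|r̂_j - r_j| (Δ_j^{q_j})^{2/3} ≤ B`, where `q_j` maximises the contrast function at `r̂_j`
(list positions start from `0`). -/
def IsAccurate {d : ℕ} (N : ℕ) (r : ℕ → ℕ) (f X : ℕ → Fin d → ℝ) (B : ℝ)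
    (Ds : List Detection) : Prop :=
  Ds.length = N ∧
    ∀ (i : ℕ) (hi : i < Ds.length) (q : Fin d), IsMaxComponent X Ds[i] q →
      |(Ds[i].loc : ℝ) - r (i + 1)| * slopeChange f (r (i + 1)) q ^ (2 / 3 : ℝ) ≤ B

end

end MID

/-!
The contrast vector `φ_{s,e}^b` is the unit vector, orthogonal to the affine sequences on `[s, e]`,
in the span of the affine sequences and the hinge `(t - b)₊`. Hence for a signal with a single kink
of size `Δ` at `r` inside `[s, e]`, the inner product with `φ^b` is `A ρ`, where `A` is the signed
distance of the signal from the affine sequences and `ρ = ⟨φ^b, φ^r⟩`, and `A² (1 - ρ²)` is the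
squared distance of the signal from the sequences with a kink at `b`. Both distances are bounded
below locally: on `[r - k, r + k]` a kink of size `Δ` has squared distance at least `Δ² k³ / 24`
from the affine sequences (`sq_mul_cube_le_sum_sq`).

A union bound over at most `T ^ 4 d` Gaussian variables shows that with probability at least
`1 - 2 / T` the noise is at most a multiple `L` of `√(log (T d^{1/4}))` along all contrast vectors and
along all normalised residuals `φ^r - ρ φ^b` (`one_sub_le_measureReal_noiseBound`). On this event
everything is deterministic. Without a change-point an interval gives no detection
(`contrast_linear_le`), and with a single change-point far from both ends it gives one
(`le_contrast_of_kink`). If `b` beats the true location `r` in an interval with one change-point,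
then `A² (1 - ρ²) ≤ 9 L²`, and this together with the fact that the threshold was exceeded bounds
`|b - r|³ Δ²` by a multiple of `L²` (`cube_mul_sq_le_of_contrast_le`). A detection at `b` is the
maximum over the components as well, so that `b` beats `r` in the component `q_j` itself.

Finally, as `lam ≤ δ_T / m` with `m > 1`, the expanding intervals reach every outermost remaining
change-point, by a margin proportional to `δ_T`, before they come too close to the next one. By
induction every detection belongs to exactly one change-point, and the search restarts in an
interval whose remaining change-points are again far from its ends
(`ReliableTests.forall₂_midAux`).
-/

namespace MID

/-! ### The contrast vector -/

/-- The hinge function `(t - b)₊`, in which the truncation of natural subtraction is intended. -/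
def hinge (b t : ℕ) : ℝ := ((t - b : ℕ) : ℝ)

/-- Minus the change of slope of `φ_{s,e}^b` at `b`: the slope on the left of `b` minus the slope on
the right. -/
noncomputable def contrastKink (s e b : ℝ) : ℝ :=
  contrastAlpha s e b * contrastBeta s e b * (e + 2 * b - 3 * s + 2) +
    contrastAlpha s e b / contrastBeta s e b * (3 * e - 2 * b - s + 2)

lemma sum_range_quadratic {F : ℕ → ℝ} (A B C : ℝ) (hF : ∀ i : ℕ, F i = A * (i : ℝ) ^ 2 + B * i + C)
    (n : ℕ) :
    ∑ i ∈ Finset.range n, F i =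
      A * (n * (n - 1) * (2 * n - 1) / 6) + B * (n * (n - 1) / 2) + C * n := by
  induction n with
  | zero => simp
  | succ n ih =>
    rw [Finset.sum_range_succ, ih, hF]
    push_cast
    ring

lemma contrastAlpha_pos {s e b : ℝ} (hb : s < b) (he : b < e) : 0 < contrastAlpha s e b := by
  have h1 : 0 < b - s := by linarith
  have h2 : 0 < e - b := by linarith
  have h3 : 0 < (e - s + 1) ^ 2 - 1 := by nlinarith
  have h4 : 0 < e - s + 1 := by linarith
  have h5 : 0 < e - b + 1 := by linarith
  have h6 : 0 < b - s + 1 := by linarith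
  unfold contrastAlpha
  positivity

lemma contrastBeta_pos {s e b : ℝ} (hb : s < b) (he : b < e) : 0 < contrastBeta s e b := by
  have h1 : 0 < b - s := by linarith
  have h2 : 0 < e - b := by linarith
  have h5 : 0 < e - b + 1 := by linarith
  have h6 : 0 < b - s + 1 := by linarith
  unfold contrastBeta
  positivity

lemma contrastKink_pos {s e b : ℝ} (hb : s < b) (he : b < e) : 0 < contrastKink s e b := by
  have h1 := contrastAlpha_pos hb he
  have h2 := contrastBeta_pos hb he
  have h3 : 0 < e + 2 * b - 3 * s + 2 := by linarith
  have h4 : 0 < 3 * e - 2 * b - s + 2 := by linarith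
  unfold contrastKink
  positivity

lemma contrastAlpha_sq (s p w : ℝ) (hp : 0 < p) (hw : 0 < w) :
    contrastAlpha s (s + p + w) (s + p) ^ 2 =
      6 / ((p + w + 1) * ((p + w) * (p + w + 2)) * (1 + (w + 1) * (p + 1) + w * p)) := by
  unfold contrastAlpha
  rw [show s + p + w - s + 1 = p + w + 1 by ring, show s + p + w - (s + p) = w by ring,
    show s + p - s = p by ring, show (p + w + 1) ^ 2 - 1 = (p + w) * (p + w + 2) by ring,
    Real.sq_sqrt (by positivity)]

lemma contrastBeta_sq (s p w : ℝ) (hp : 0 < p) (hw : 0 < w) :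
    contrastBeta s (s + p + w) (s + p) ^ 2 = (w + 1) * w / ((p + 1) * p) := by
  unfold contrastBeta
  rw [show s + p + w - (s + p) = w by ring, show s + p - s = p by ring,
    Real.sq_sqrt (by positivity)]

lemma contrastVec_left (s p w i : ℕ) (hi : i ≤ p) :
    contrastVec s (s + p + w) (s + p) (s + i) =
      contrastAlpha s (s + p + w) (s + p) * contrastBeta s (s + p + w) (s + p) *
        ((3 * p + w + 2) * i - p * (p + w)) := by
  unfold contrastVec
  rw [if_pos ⟨by omega, by omega⟩]
  push_cast
  ring

lemma contrastVec_right (s p w i : ℕ) (hi : i < w) :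
    contrastVec s (s + p + w) (s + p) (s + p + 1 + i) =
      contrastAlpha s (s + p + w) (s + p) / contrastBeta s (s + p + w) (s + p) *
        ((p + 3 * w + 2) * (w - 1 - i) - w * (p + w)) := by
  unfold contrastVec
  rw [if_neg (by omega), if_pos ⟨by omega, by omega⟩]
  push_cast
  ring

lemma sum_Icc_split (F : ℕ → ℝ) (s p w : ℕ) :
    ∑ t ∈ Finset.Icc s (s + p + w), F t =
      ∑ i ∈ Finset.range (p + 1), F (s + i) + ∑ i ∈ Finset.range w, F (s + p + 1 + i) := by
  have h : Finset.Icc s (s + p + w) = Finset.Ico s (s + p + w + 1) := by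
    ext t; simp
  rw [h, ← Finset.sum_Ico_consecutive F (show s ≤ s + p + 1 by omega) (by omega),
    Finset.sum_Ico_eq_sum_range, Finset.sum_Ico_eq_sum_range,
    show s + p + 1 - s = p + 1 by omega, show s + p + w + 1 - (s + p + 1) = w by omega]

/-- Sums against `φ_{s,e}^b` in terms of the left length `p = b - s` and the right length
`w = e - b`, with the factor `α / β` pulled out so that only the rational number `β ^ 2` remains. -/
lemma sum_mul_contrastVec (F : ℕ → ℝ) (s p w : ℕ) (hp : 0 < p) (hw : 0 < w) :
    ∑ t ∈ Finset.Icc s (s + p + w), F t * contrastVec s (s + p + w) (s + p) t =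
      contrastAlpha s (s + p + w) (s + p) / contrastBeta s (s + p + w) (s + p) *
        ((w + 1) * w / ((p + 1) * p) *
          ∑ i ∈ Finset.range (p + 1), F (s + i) * ((3 * p + w + 2) * i - p * (p + w)) +
        ∑ i ∈ Finset.range w,
          F (s + p + 1 + i) * ((p + 3 * w + 2) * (w - 1 - i) - w * (p + w))) := by
  have hp' : (0 : ℝ) < p := by exact_mod_cast hp
  have hw' : (0 : ℝ) < w := by exact_mod_cast hw
  have hβ := contrastBeta_pos (s := s) (b := s + p) (e := s + p + w) (by linarith) (by linarith)
  rw [← contrastBeta_sq s p w hp' hw', sum_Icc_split, mul_add, ← mul_assoc, Finset.mul_sum,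
    Finset.mul_sum]
  congr 1
  · refine Finset.sum_congr rfl fun i hi => ?_
    rw [contrastVec_left s p w i (by simp at hi; omega)]
    field_simp
  · refine Finset.sum_congr rfl fun i hi => ?_
    rw [contrastVec_right s p w i (by simpa using hi)]
    ring

lemma exists_eq_add_add {s b e : ℕ} (hb : s < b) (he : b < e) :
    ∃ p w, 0 < p ∧ 0 < w ∧ b = s + p ∧ e = s + p + w :=
  ⟨b - s, e - b, by omega, by omega, by omega, by omega⟩

lemma sum_contrastVec {s b e : ℕ} (hb : s < b) (he : b < e) :
    ∑ t ∈ Finset.Icc s e, contrastVec s e b t = 0 := by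
  obtain ⟨p, w, hp, hw, rfl, rfl⟩ := exists_eq_add_add hb he
  have h := sum_mul_contrastVec (fun _ => 1) s p w hp hw
  simp only [one_mul] at h
  rw [h, sum_range_quadratic 0 (3 * p + w + 2) (-(p * (p + w))) (fun i => by ring),
    sum_range_quadratic 0 (-(p + 3 * w + 2)) ((p + 3 * w + 2) * (w - 1) - w * (p + w))
      (fun i => by ring)]
  push_cast
  field_simp
  ring

lemma sum_id_mul_contrastVec {s b e : ℕ} (hb : s < b) (he : b < e) :
    ∑ t ∈ Finset.Icc s e, (t : ℝ) * contrastVec s e b t = 0 := by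
  have h0 := sum_contrastVec hb he
  obtain ⟨p, w, hp, hw, rfl, rfl⟩ := exists_eq_add_add hb he
  have h := sum_mul_contrastVec (fun t => (t : ℝ) - s) s p w hp hw
  have h1 : ∑ t ∈ Finset.Icc s (s + p + w), (t : ℝ) * contrastVec s (s + p + w) (s + p) t =
      ∑ t ∈ Finset.Icc s (s + p + w), ((t : ℝ) - s) * contrastVec s (s + p + w) (s + p) t := by
    simp only [sub_mul, Finset.sum_sub_distrib, ← Finset.mul_sum, h0, mul_zero, sub_zero]
  rw [h1, h, sum_range_quadratic (3 * p + w + 2) (-(p * (p + w))) 0 (fun i => by push_cast; ring),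
    sum_range_quadratic (-(p + 3 * w + 2))
      ((p + 3 * w + 2) * (w - 1) - w * (p + w) - (p + 1) * (p + 3 * w + 2))
      ((p + 1) * ((p + 3 * w + 2) * (w - 1) - w * (p + w)))
      (fun i => by push_cast; ring)]
  push_cast
  field_simp
  ring

lemma sum_contrastVec_sq {s b e : ℕ} (hb : s < b) (he : b < e) :
    ∑ t ∈ Finset.Icc s e, contrastVec s e b t ^ 2 = 1 := by
  obtain ⟨p, w, hp, hw, rfl, rfl⟩ := exists_eq_add_add hb he
  have hp' : (0 : ℝ) < p := by exact_mod_cast hp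
  have hw' : (0 : ℝ) < w := by exact_mod_cast hw
  have hβ := contrastBeta_pos (s := s) (b := s + p) (e := s + p + w) (by linarith) (by linarith)
  have hα2 := contrastAlpha_sq s p w hp' hw'
  have hβ2 := contrastBeta_sq s p w hp' hw'
  rw [sum_Icc_split,
    Finset.sum_congr rfl fun i hi => congrArg (· ^ 2)
      (contrastVec_left s p w i (by simp at hi; omega)),
    Finset.sum_congr rfl fun i hi => congrArg (· ^ 2)
      (contrastVec_right s p w i (by simpa using hi))]
  simp only [mul_pow, div_pow, hα2, hβ2, ← Finset.mul_sum]
  rw [sum_range_quadratic ((3 * p + w + 2) ^ 2) (-(2 * (3 * p + w + 2) * (p * (p + w))))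
      ((p * (p + w)) ^ 2) (fun i => by ring),
    sum_range_quadratic ((p + 3 * w + 2) ^ 2)
      (-(2 * (p + 3 * w + 2) * ((p + 3 * w + 2) * (w - 1) - w * (p + w))))
      (((p + 3 * w + 2) * (w - 1) - w * (p + w)) ^ 2) (fun i => by ring)]
  push_cast
  field_simp
  ring

/-- On `[s, e]` the vector `φ_{s,e}^b` is an affine function minus a positive multiple of the hinge
at `b`. The two pieces meet at `b` because of the value of the balancing factor `β`. -/
lemma exists_contrastVec_eq {s b e : ℕ} (hb : s < b) (he : b < e) :
    ∃ a c : ℝ, ∀ t ∈ Finset.Icc s e,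
      contrastVec s e b t = a + c * t - contrastKink s e b * hinge b t := by
  obtain ⟨p, w, hp, hw, rfl, rfl⟩ := exists_eq_add_add hb he
  have hp' : (0 : ℝ) < p := by exact_mod_cast hp
  have hw' : (0 : ℝ) < w := by exact_mod_cast hw
  have hβ := contrastBeta_pos (s := s) (b := s + p) (e := s + p + w) (by linarith) (by linarith)
  have hβ2 := contrastBeta_sq s p w hp' hw'
  refine ⟨contrastAlpha s (s + p + w) (s + p) * contrastBeta s (s + p + w) (s + p) *
        (-(3 * p + w + 2) * s - p * (p + w)), contrastAlpha s (s + p + w) (s + p) *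
        contrastBeta s (s + p + w) (s + p) * (3 * p + w + 2), fun t ht => ?_⟩
  rw [Finset.mem_Icc] at ht
  rcases le_or_gt t (s + p) with h | h
  · obtain ⟨i, rfl⟩ := Nat.exists_eq_add_of_le ht.1
    rw [contrastVec_left s p w i (by omega), hinge, Nat.sub_eq_zero_of_le h]
    push_cast
    ring
  · obtain ⟨i, rfl⟩ := Nat.exists_eq_add_of_le (show s + p + 1 ≤ t from h)
    rw [contrastVec_right s p w i (by omega), hinge,
      show s + p + 1 + i - (s + p) = 1 + i by omega, contrastKink]
    push_cast
    generalize contrastAlpha (s : ℝ) (s + p + w) (s + p) = α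
    generalize contrastBeta (s : ℝ) (s + p + w) (s + p) = β at *
    have : α * β = α / β * ((w + 1) * w / ((p + 1) * p)) := by
      rw [← hβ2]; field_simp
    rw [this]
    field_simp
    ring

/-- For the symmetric interval around `r` with radius `k`, where `β = 1`, the squared kink is
`12 (2k + 1) / (k (k + 1) (k² + k + 1))`. -/
lemma contrastKink_sq_mul_le (r k : ℕ) (hk : 0 < k) (hr : k ≤ r) :
    contrastKink (r - k : ℕ) (r + k : ℕ) r ^ 2 * (k : ℝ) ^ 3 ≤ 24 := by
  obtain ⟨s, rfl⟩ := Nat.exists_eq_add_of_le' hr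
  have hk' : (0 : ℝ) < k := by exact_mod_cast hk
  have hα2 := contrastAlpha_sq s k k hk' hk'
  have hβ2 := contrastBeta_sq s k k hk' hk'
  have hβ := contrastBeta_pos (s := s) (b := s + k) (e := s + k + k) (by linarith) (by linarith)
  have hβ1 : contrastBeta s (s + k + k) (s + k) = 1 := by
    rw [div_self (by positivity)] at hβ2
    exact (pow_eq_one_iff_of_nonneg hβ.le two_ne_zero).1 hβ2
  rw [Nat.add_sub_cancel, contrastKink]
  push_cast
  rw [hβ1, mul_one, div_one, ← mul_add, mul_pow, hα2]
  rw [div_mul_eq_mul_div, div_mul_eq_mul_div, div_le_iff₀ (by positivity), ← sub_nonneg]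
  ring_nf
  positivity

/-! ### Geometry of the kinked signals -/

/-- The inner product of the unit vectors `φ_{s,e}^b` and `φ_{s,e}^r`. -/
noncomputable def contrastCorr (s e b r : ℕ) : ℝ :=
  ∑ t ∈ Finset.Icc s e, contrastVec s e b t * contrastVec s e r t

/-- The component of `φ_{s,e}^r` orthogonal to `φ_{s,e}^b`. -/
noncomputable def residualVec (s e b r t : ℕ) : ℝ :=
  contrastVec s e r t - contrastCorr s e b r * contrastVec s e b t

/-- The contrast vector does not see the affine part of a signal with one kink. -/
lemma sum_mul_contrastVec_of_kink {s e b : ℕ} (hb : s < b) (he : b < e) {x : ℕ → ℝ} {a c D : ℝ}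
    {r : ℕ} (hx : ∀ t ∈ Finset.Icc s e, x t = a + c * t + D * hinge r t) :
    ∑ t ∈ Finset.Icc s e, x t * contrastVec s e b t =
      D * ∑ t ∈ Finset.Icc s e, hinge r t * contrastVec s e b t := by
  calc _ = ∑ t ∈ Finset.Icc s e, (a * contrastVec s e b t + c * (t * contrastVec s e b t) +
        D * (hinge r t * contrastVec s e b t)) :=
        Finset.sum_congr rfl fun t ht => by rw [hx t ht]; ring
    _ = _ := by
      simp only [Finset.sum_add_distrib, ← Finset.mul_sum, sum_contrastVec hb he,
        sum_id_mul_contrastVec hb he, mul_zero, zero_add]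

lemma contrastKink_mul_sum_hinge {s e b r : ℕ} (hb : s < b) (he : b < e) (hr : s < r)
    (hre : r < e) :
    contrastKink s e r * ∑ t ∈ Finset.Icc s e, hinge r t * contrastVec s e b t =
      -contrastCorr s e b r := by
  obtain ⟨a, c, h⟩ := exists_contrastVec_eq hr hre
  have := sum_mul_contrastVec_of_kink hb he (x := contrastVec s e r) (a := a) (c := c)
    (D := -contrastKink s e r) (r := r) (fun t ht => by rw [h t ht]; ring)
  simp only [contrastCorr, mul_comm (contrastVec s e b _) (contrastVec s e r _), this]
  ring

lemma contrastCorr_self {s e b : ℕ} (hb : s < b) (he : b < e) : contrastCorr s e b b = 1 := by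
  rw [← sum_contrastVec_sq hb he, contrastCorr]
  exact Finset.sum_congr rfl fun t _ => by ring

lemma sum_residualVec_sq {s e b r : ℕ} (hb : s < b) (he : b < e) (hr : s < r) (hre : r < e) :
    ∑ t ∈ Finset.Icc s e, residualVec s e b r t ^ 2 = 1 - contrastCorr s e b r ^ 2 := by
  calc _ = ∑ t ∈ Finset.Icc s e, (contrastVec s e r t ^ 2 +
        (contrastCorr s e b r ^ 2 * contrastVec s e b t ^ 2 -
        2 * contrastCorr s e b r * (contrastVec s e b t * contrastVec s e r t))) :=
        Finset.sum_congr rfl fun t _ => by rw [residualVec]; ring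
    _ = _ := by
      rw [Finset.sum_add_distrib, Finset.sum_sub_distrib, ← Finset.mul_sum, ← Finset.mul_sum,
        sum_contrastVec_sq hb he, sum_contrastVec_sq hr hre, ← contrastCorr]
      ring

lemma one_sub_contrastCorr_sq_nonneg {s e b r : ℕ} (hb : s < b) (he : b < e) (hr : s < r)
    (hre : r < e) : 0 ≤ 1 - contrastCorr s e b r ^ 2 := by
  rw [← sum_residualVec_sq hb he hr hre]
  exact Finset.sum_nonneg fun t _ => sq_nonneg _

lemma sq_sum_mul_contrastVec_le {s e b : ℕ} (hb : s < b) (he : b < e) (x : ℕ → ℝ) :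
    (∑ t ∈ Finset.Icc s e, x t * contrastVec s e b t) ^ 2 ≤ ∑ t ∈ Finset.Icc s e, x t ^ 2 := by
  have := Finset.sum_mul_sq_le_sq_mul_sq (Finset.Icc s e) x (contrastVec s e b)
  rwa [sum_contrastVec_sq hb he, mul_one] at this

/-- A sequence with a kink of size `D` at `r` has squared norm at least `D² k³ / 24` over
`[r - k, r + k]`: apply Cauchy–Schwarz to its inner product with the contrast vector of that
interval. -/
lemma sq_mul_cube_le_sum_sq {r k : ℕ} (hk : k ≤ r) {y : ℕ → ℝ} {a c D : ℝ}
    (hy : ∀ t ∈ Finset.Icc (r - k) (r + k), y t = a + c * t + D * hinge r t) :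
    D ^ 2 * (k : ℝ) ^ 3 ≤ 24 * ∑ t ∈ Finset.Icc (r - k) (r + k), y t ^ 2 := by
  rcases Nat.eq_zero_or_pos k with rfl | hk0
  · simp only [Nat.cast_zero]
    have : 0 ≤ ∑ t ∈ Finset.Icc (r - 0) (r + 0), y t ^ 2 := Finset.sum_nonneg fun t _ => sq_nonneg _
    linarith
  have h1 : r - k < r := by omega
  have h2 : r < r + k := by omega
  have h3 := sq_sum_mul_contrastVec_le h1 h2 y
  have h4 := contrastKink_mul_sum_hinge h1 h2 h1 h2
  rw [contrastCorr_self h1 h2] at h4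
  have h5 := contrastKink_sq_mul_le r k hk0 hk
  rw [sum_mul_contrastVec_of_kink h1 h2 hy] at h3
  set κ := contrastKink (r - k : ℕ) (r + k : ℕ) r
  set H := ∑ t ∈ Finset.Icc (r - k) (r + k), hinge r t * contrastVec (r - k) (r + k) r t
  set S := ∑ t ∈ Finset.Icc (r - k) (r + k), y t ^ 2
  have h6 : D ^ 2 = κ ^ 2 * (D * H) ^ 2 := by
    rw [show κ ^ 2 * (D * H) ^ 2 = D ^ 2 * (κ * H) ^ 2 by ring, h4]; ring
  have hk3 : (0 : ℝ) ≤ (k : ℝ) ^ 3 := by positivity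
  calc D ^ 2 * (k : ℝ) ^ 3 = (κ ^ 2 * (k : ℝ) ^ 3) * (D * H) ^ 2 := by rw [h6]; ring
    _ ≤ 24 * S := mul_le_mul h5 h3 (sq_nonneg _) (by norm_num)

/-- The squared distance `1 / contrastKink ^ 2` of the hinge at `r` from the affine functions on
`[s, e]` is at least `k³ / 24` when `r` is at distance at least `k` from both ends. -/
lemma contrastKink_sq_mul_cube_le {s e r k : ℕ} (hk : 0 < k) (hs : s + k ≤ r) (he : r + k ≤ e) :
    contrastKink s e r ^ 2 * (k : ℝ) ^ 3 ≤ 24 := by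
  have hr : s < r := by omega
  have hre : r < e := by omega
  obtain ⟨a, c, h⟩ := exists_contrastVec_eq hr hre
  have hsub : Finset.Icc (r - k) (r + k) ⊆ Finset.Icc s e :=
    Finset.Icc_subset_Icc (by omega) (by omega)
  have h1 := sq_mul_cube_le_sum_sq (k := k) (r := r) (by omega) (y := contrastVec s e r) (a := a)
    (c := c) (D := -contrastKink s e r) (fun t ht => by rw [h t (hsub ht)]; ring)
  have h2 := Finset.sum_le_sum_of_subset_of_nonneg hsub
    (f := fun t => contrastVec s e r t ^ 2) fun t _ _ => sq_nonneg _
  rw [sum_contrastVec_sq hr hre] at h2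
  nlinarith

/-- The distance of the hinge at `r` from the functions on `[s, e]` with a kink at `b`. If `b` is at
distance at least `k` from `r`, such functions are affine on `[r - k, r + k]`, so that the residual
has the full kink of `φ_{s,e}^r` there. -/
lemma contrastKink_sq_mul_cube_le_residual {s e b r k : ℕ} (hb : s < b) (hbe : b < e) (hr : s < r)
    (hre : r < e) (hs : s + k ≤ r) (he : r + k ≤ e) (hbr : b + k ≤ r ∨ r + k ≤ b) :
    contrastKink s e r ^ 2 * (k : ℝ) ^ 3 ≤ 24 * (1 - contrastCorr s e b r ^ 2) := by
  obtain ⟨a, c, h⟩ := exists_contrastVec_eq hr hre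
  obtain ⟨a', c', h'⟩ := exists_contrastVec_eq hb hbe
  have hsub : Finset.Icc (r - k) (r + k) ⊆ Finset.Icc s e :=
    Finset.Icc_subset_Icc (by omega) (by omega)
  obtain ⟨a'', c'', h''⟩ : ∃ a'' c'' : ℝ, ∀ t ∈ Finset.Icc (r - k) (r + k),
      hinge b t = a'' + c'' * t := by
    rcases hbr with hbr | hbr
    · refine ⟨-b, 1, fun t ht => ?_⟩
      rw [Finset.mem_Icc] at ht
      rw [hinge, Nat.cast_sub (by omega)]
      ring
    · refine ⟨0, 0, fun t ht => ?_⟩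
      rw [Finset.mem_Icc] at ht
      rw [hinge, Nat.sub_eq_zero_of_le (by omega)]
      simp
  set ρ := contrastCorr s e b r with hρ
  have h1 := sq_mul_cube_le_sum_sq (k := k) (r := r) (by omega) (y := residualVec s e b r)
    (a := a - ρ * (a' - contrastKink s e b * a''))
    (c := c - ρ * (c' - contrastKink s e b * c'')) (D := -contrastKink s e r)
    (fun t ht => by
      rw [residualVec, h t (hsub ht), h' t (hsub ht), h'' t ht, ← hρ]; ring)
  have h2 := Finset.sum_le_sum_of_subset_of_nonneg hsub
    (f := fun t => residualVec s e b r t ^ 2) fun t _ _ => sq_nonneg _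
  rw [sum_residualVec_sq hb hbe hr hre] at h2
  nlinarith

/-- The distance of the hinge at `r` from the affine functions on `[s, e]` is at most the norm of
the hinge itself. -/
lemma one_le_contrastKink_sq_mul_right {s e r : ℕ} (hr : s < r) (hre : r < e) :
    1 ≤ contrastKink s e r ^ 2 * ((e - r : ℕ) : ℝ) ^ 3 := by
  have h1 := contrastKink_mul_sum_hinge hr hre hr hre
  rw [contrastCorr_self hr hre] at h1
  have h2 := sq_sum_mul_contrastVec_le hr hre (hinge r)
  have h3 : ∑ t ∈ Finset.Icc s e, hinge r t ^ 2 ≤ ((e - r : ℕ) : ℝ) ^ 3 := by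
    calc ∑ t ∈ Finset.Icc s e, hinge r t ^ 2 = ∑ t ∈ Finset.Ioc r e, hinge r t ^ 2 := by
          refine (Finset.sum_subset (fun t ht => ?_) fun t ht ht' => ?_).symm
          · simp at ht ⊢; omega
          · have : t - r = 0 := by simp at ht ht'; omega
            simp [hinge, this]
      _ ≤ ∑ t ∈ Finset.Ioc r e, ((e - r : ℕ) : ℝ) ^ 2 := by
          refine Finset.sum_le_sum fun t ht => ?_
          have : t - r ≤ e - r := by simp at ht; omega
          have : ((t - r : ℕ) : ℝ) ≤ (e - r : ℕ) := by exact_mod_cast this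
          unfold hinge
          gcongr
      _ = _ := by rw [Finset.sum_const, Nat.card_Ioc, nsmul_eq_mul]; ring
  calc (1 : ℝ) = contrastKink s e r ^ 2 *
        (∑ t ∈ Finset.Icc s e, hinge r t * contrastVec s e r t) ^ 2 := by
        rw [← mul_pow, h1]; norm_num
    _ ≤ _ := by gcongr; exact h2.trans h3

/-- The mirror image of `one_le_contrastKink_sq_mul_right`: subtracting the affine function `t - r`
turns the hinge at `r` into `(r - t)₊`. -/
lemma one_le_contrastKink_sq_mul_left {s e r : ℕ} (hr : s < r) (hre : r < e) :
    1 ≤ contrastKink s e r ^ 2 * ((r - s : ℕ) : ℝ) ^ 3 := by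
  have h1 := contrastKink_mul_sum_hinge hr hre hr hre
  rw [contrastCorr_self hr hre] at h1
  have h2 := sq_sum_mul_contrastVec_le hr hre fun t => ((r - t : ℕ) : ℝ)
  have h0 := sum_mul_contrastVec_of_kink hr hre (x := fun t => ((r - t : ℕ) : ℝ)) (a := r)
    (c := -1) (D := 1) (r := r) fun t _ => by
      rcases le_total t r with h | h
      · simp only [hinge, Nat.sub_eq_zero_of_le h, Nat.cast_sub h]; simp; ring
      · simp only [hinge, Nat.sub_eq_zero_of_le h, Nat.cast_sub h]; simp; ring
  rw [h0, one_mul] at h2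
  have h3 : ∑ t ∈ Finset.Icc s e, ((r - t : ℕ) : ℝ) ^ 2 ≤ ((r - s : ℕ) : ℝ) ^ 3 := by
    calc ∑ t ∈ Finset.Icc s e, ((r - t : ℕ) : ℝ) ^ 2
        = ∑ t ∈ Finset.Ico s r, ((r - t : ℕ) : ℝ) ^ 2 := by
          refine (Finset.sum_subset (fun t ht => ?_) fun t ht ht' => ?_).symm
          · simp at ht ⊢; omega
          · have : r - t = 0 := by simp at ht ht'; omega
            simp [this]
      _ ≤ ∑ t ∈ Finset.Ico s r, ((r - s : ℕ) : ℝ) ^ 2 := by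
          refine Finset.sum_le_sum fun t ht => ?_
          have : r - t ≤ r - s := by simp at ht; omega
          have : ((r - t : ℕ) : ℝ) ≤ (r - s : ℕ) := by exact_mod_cast this
          gcongr
      _ = _ := by rw [Finset.sum_const, Nat.card_Ico, nsmul_eq_mul]; ring
  calc (1 : ℝ) = contrastKink s e r ^ 2 *
        (∑ t ∈ Finset.Icc s e, hinge r t * contrastVec s e r t) ^ 2 := by
        rw [← mul_pow, h1]; norm_num
    _ ≤ _ := by gcongr; exact h2.trans h3

/-! ### One component: detection and localisation -/

/-- The noise `z` is at most `L` in the direction of all contrast vectors of subintervals of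
`[1, T]` and of all normalised residuals. The second bound is stated without division, which avoids the
degenerate residual `0`. -/
structure NoiseBound (T : ℕ) (z : ℕ → ℝ) (L : ℝ) : Prop where
  contrast_le : ∀ s b e, 1 ≤ s → s < b → b < e → e ≤ T → contrast s e b z ≤ L
  residual_le : ∀ s b r e, 1 ≤ s → s < b → b < e → s < r → r < e → e ≤ T →
    |∑ t ∈ Finset.Icc s e, z t * residualVec s e b r t| ≤ L * √(1 - contrastCorr s e b r ^ 2)

/-- Without a change-point in `[s, e]` the contrast function sees only noise. -/
lemma contrast_linear_le {T : ℕ} {z x : ℕ → ℝ} {L : ℝ} (hz : NoiseBound T z L) {s b e : ℕ}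
    (hs : 1 ≤ s) (hb : s < b) (he : b < e) (heT : e ≤ T) {a c : ℝ}
    (hx : ∀ t ∈ Finset.Icc s e, x t = a + c * t + z t) : contrast s e b x ≤ L := by
  have h1 := sum_mul_contrastVec_of_kink hb he (x := fun t => a + c * t) (a := a) (c := c)
    (D := 0) (r := 0) (fun t _ => by ring)
  rw [zero_mul] at h1
  have : ∑ t ∈ Finset.Icc s e, x t * contrastVec s e b t =
      ∑ t ∈ Finset.Icc s e, z t * contrastVec s e b t := by
    rw [← zero_add (∑ t ∈ Finset.Icc s e, z t * contrastVec s e b t), ← h1,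
      ← Finset.sum_add_distrib]
    exact Finset.sum_congr rfl fun t ht => by rw [hx t ht]; ring
  rw [contrast, this]
  exact hz.contrast_le s b e hs hb he heT

lemma sum_mul_contrastVec_of_kink_add {s b e r : ℕ} (hb : s < b) (he : b < e) (hr : s < r)
    (hre : r < e) {x z : ℕ → ℝ} {a c D : ℝ}
    (hx : ∀ t ∈ Finset.Icc s e, x t = a + c * t + D * hinge r t + z t) :
    ∑ t ∈ Finset.Icc s e, x t * contrastVec s e b t =
      -(D / contrastKink s e r) * contrastCorr s e b r +
        ∑ t ∈ Finset.Icc s e, z t * contrastVec s e b t := by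
  have h1 := sum_mul_contrastVec_of_kink hb he (x := fun t => a + c * t + D * hinge r t) (a := a)
    (c := c) (D := D) (r := r) (fun t _ => rfl)
  have h2 := contrastKink_mul_sum_hinge hb he hr hre
  have hκ : 0 < contrastKink s e r :=
    contrastKink_pos (by exact_mod_cast hr) (by exact_mod_cast hre)
  rw [show -(D / contrastKink s e r) * contrastCorr s e b r =
    D / contrastKink s e r * (-contrastCorr s e b r) by ring, ← h2, ← mul_assoc,
    div_mul_cancel₀ _ hκ.ne', ← h1, ← Finset.sum_add_distrib]
  exact Finset.sum_congr rfl fun t ht => by rw [hx t ht]; ring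

/-- A change of slope `D` at distance at least `k` from both ends gives a contrast of order
`|D| k ^ (3/2)`. -/
lemma le_contrast_of_kink {T : ℕ} {z x : ℕ → ℝ} {L : ℝ} (hz : NoiseBound T z L) {s r e k : ℕ}
    (hs : 1 ≤ s) (hk : 0 < k) (hr : s + k ≤ r) (hre : r + k ≤ e) (heT : e ≤ T) {a c D : ℝ}
    (hx : ∀ t ∈ Finset.Icc s e, x t = a + c * t + D * hinge r t + z t) :
    |D| * √((k : ℝ) ^ 3) / 5 - L ≤ contrast s e r x := by
  have hr' : s < r := by omega
  have hre' : r < e := by omega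
  have hκ : 0 < contrastKink s e r :=
    contrastKink_pos (by exact_mod_cast hr') (by exact_mod_cast hre')
  have h1 := sum_mul_contrastVec_of_kink_add hr' hre' hr' hre' hx
  rw [contrastCorr_self hr' hre'] at h1
  have h2 := hz.contrast_le s r e hs hr' hre' heT
  rw [contrast] at h2 ⊢
  have h3 := contrastKink_sq_mul_cube_le hk hr hre
  have h4 : contrastKink s e r * √((k : ℝ) ^ 3) ≤ 5 := by
    refine abs_le_of_sq_le_sq' ?_ (by norm_num) |>.2
    rw [mul_pow, Real.sq_sqrt (by positivity)]
    linarith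
  have h5 : |D| * √((k : ℝ) ^ 3) / 5 ≤ |D / contrastKink s e r| := by
    rw [abs_div, abs_of_pos hκ, div_le_div_iff₀ (by norm_num) hκ, mul_assoc, mul_comm (√_)]
    exact mul_le_mul_of_nonneg_left h4 (abs_nonneg _)
  rw [h1, mul_one]
  set Z := ∑ t ∈ Finset.Icc s e, z t * contrastVec s e r t
  have h6 := abs_sub_abs_le_abs_sub (-(D / contrastKink s e r)) (-Z)
  rw [abs_neg, abs_neg, sub_neg_eq_add] at h6
  linarith

/-- Comparison of the contrasts at the true location (`A + Zr`) and at another one (`A ρ + Zb`). The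
gain `A² (1 - ρ²)` of the true location is controlled by noise in two unit directions only, since
`A (Zr - ρ Zb)` is the noise along the residual. -/
lemma sq_mul_le_of_abs_add_le {A ρ Zb Zr L τ : ℝ} (hL : 0 ≤ L) (hτ0 : 0 ≤ τ)
    (hτ : τ ^ 2 = 1 - ρ ^ 2) (hmax : |A + Zr| ≤ |A * ρ + Zb|) (hzb : |Zb| ≤ L)
    (hzr : |Zr - ρ * Zb| ≤ L * τ) : A ^ 2 * (1 - ρ ^ 2) ≤ 9 * L ^ 2 := by
  have h1 : (A + Zr) ^ 2 ≤ (A * ρ + Zb) ^ 2 := sq_le_sq.2 hmax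
  have h2 : Zb ^ 2 ≤ L ^ 2 := sq_le_sq.2 (by rwa [abs_of_nonneg hL])
  have h3 : -(A * (Zr - ρ * Zb)) ≤ |A| * τ * L := by
    refine (neg_le_abs _).trans ?_
    rw [abs_mul, mul_assoc, mul_comm τ]
    exact mul_le_mul_of_nonneg_left hzr (abs_nonneg _)
  have hx : A ^ 2 * (1 - ρ ^ 2) = (|A| * τ) ^ 2 := by rw [mul_pow, sq_abs, hτ]
  have hx0 : 0 ≤ |A| * τ := mul_nonneg (abs_nonneg A) hτ0
  rw [hx]
  have h4 : (|A| * τ) ^ 2 ≤ L ^ 2 + 2 * (|A| * τ * L) := by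
    rw [← hx]
    linarith [sq_nonneg Zr, h1, h2, h3]
  generalize |A| * τ = y at *
  have h5 : y ≤ 3 * L := by
    by_contra! h
    nlinarith
  nlinarith

/-- If the contrast at `b` exceeds both the threshold and the contrast at the true change-point `r`,
then `|b - r|³ D²` is of the order of the squared noise level. The change-point may be close to an
end of the interval: then the threshold, `16` times the noise level, makes the change so large that
`b` must be closer to `r` than that end is. -/
lemma cube_mul_sq_le_of_contrast_le {T : ℕ} {z x : ℕ → ℝ} {L ζ : ℝ} (hL : 0 ≤ L)
    (hz : NoiseBound T z L) {s b r e : ℕ} (hs : 1 ≤ s) (hb : s < b) (he : b < e) (hr : s < r)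
    (hre : r < e) (heT : e ≤ T) {a c D : ℝ}
    (hx : ∀ t ∈ Finset.Icc s e, x t = a + c * t + D * hinge r t + z t)
    (hζ : 16 * L ≤ ζ) (hdet : ζ < contrast s e b x) (hmax : contrast s e r x ≤ contrast s e b x) :
    |(b : ℝ) - r| ^ 3 * D ^ 2 ≤ 216 * L ^ 2 := by
  have hκ : 0 < contrastKink s e r :=
    contrastKink_pos (by exact_mod_cast hr) (by exact_mod_cast hre)
  have hb1 := sum_mul_contrastVec_of_kink_add hb he hr hre hx
  have hr1 := sum_mul_contrastVec_of_kink_add hr hre hr hre hx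
  rw [contrastCorr_self hr hre, mul_one] at hr1
  have hρ := one_sub_contrastCorr_sq_nonneg hb he hr hre
  have hzb := hz.contrast_le s b e hs hb he heT
  have hzr := hz.residual_le s b r e hs hb he hr hre heT
  have hres : ∑ t ∈ Finset.Icc s e, z t * residualVec s e b r t =
      ∑ t ∈ Finset.Icc s e, z t * contrastVec s e r t -
        contrastCorr s e b r * ∑ t ∈ Finset.Icc s e, z t * contrastVec s e b t := by
    rw [Finset.mul_sum, ← Finset.sum_sub_distrib]
    exact Finset.sum_congr rfl fun t _ => by rw [residualVec]; ring
  rw [hres] at hzr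
  have hloc := fun k => contrastKink_sq_mul_cube_le_residual (k := k) hb he hr hre
  have hR := one_le_contrastKink_sq_mul_right hr hre
  have hLft := one_le_contrastKink_sq_mul_left hr hre
  rw [contrast] at hzb hdet hmax
  rw [contrast, hr1, hb1] at hmax
  rw [hb1] at hdet
  set κ := contrastKink s e r
  set ρ := contrastCorr s e b r
  set Zb := ∑ t ∈ Finset.Icc s e, z t * contrastVec s e b t
  set Zr := ∑ t ∈ Finset.Icc s e, z t * contrastVec s e r t
  set A := -(D / κ) with hA
  have hAD : A ^ 2 * κ ^ 2 = D ^ 2 := by rw [hA]; field_simp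
  have hτ : √(1 - ρ ^ 2) ^ 2 = 1 - ρ ^ 2 := Real.sq_sqrt hρ
  have hτ0 := Real.sqrt_nonneg (1 - ρ ^ 2)
  set τ := √(1 - ρ ^ 2)
  have hkey2 : A ^ 2 * (1 - ρ ^ 2) ≤ 9 * L ^ 2 :=
    sq_mul_le_of_abs_add_le hL hτ0 hτ hmax hzb hzr
  have hA15 : 15 * L < |A| := by
    have h1 : |A * ρ + Zb| ≤ |A| * |ρ| + |Zb| := by
      rw [← abs_mul]; exact abs_add_le _ _
    have h2 : |ρ| ≤ 1 := by
      rw [← abs_one, ← sq_le_sq]; linarith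
    have h3 := mul_le_of_le_one_right (abs_nonneg A) h2
    linarith
  have hA2 : 225 * L ^ 2 < A ^ 2 := by
    rw [← sq_abs A]; nlinarith
  have hk : ∀ k : ℕ, s + k ≤ r → r + k ≤ e → b + k ≤ r ∨ r + k ≤ b →
      D ^ 2 * (k : ℝ) ^ 3 ≤ 216 * L ^ 2 := fun k h1 h2 h3 => by
    have := hloc k h1 h2 h3
    have := mul_le_mul_of_nonneg_left this (sq_nonneg A)
    rw [← hAD]
    linarith
  -- a change-point at distance `k` from an end can be detected only if `D² k³` is large
  have hside : ∀ k : ℕ, 1 ≤ κ ^ 2 * (k : ℝ) ^ 3 → 225 * L ^ 2 < D ^ 2 * (k : ℝ) ^ 3 :=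
    fun k h => by
      have := mul_le_mul_of_nonneg_left h (sq_nonneg A)
      rw [← hAD]
      linarith
  rcases le_total b r with hbr | hbr
  · rcases le_total (r - b) (e - r) with h | h
    · have := hk (r - b) (by omega) (by omega) (by omega)
      rw [abs_sub_comm, abs_of_nonneg (by simpa using hbr), ← Nat.cast_sub hbr]
      linarith
    · have h1 := hk (e - r) (by omega) (by omega) (by omega)
      have h2 := hside _ hR
      nlinarith [sq_nonneg L]
  · rcases le_total (b - r) (r - s) with h | h
    · have := hk (b - r) (by omega) (by omega) (by omega)
      rw [abs_of_nonneg (by simpa using hbr), ← Nat.cast_sub hbr]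
      linarith
    · have h1 := hk (r - s) (by omega) (by omega) (by omega)
      have h2 := hside _ hLft
      nlinarith [sq_nonneg L]

/-! ### The search -/

lemma firstDetection_eq_none_iff {d : ℕ} (X : ℕ → Fin d → ℝ) (T lam : ℕ) (ζ : ℝ) (s e : ℕ) :
    firstDetection X T lam ζ s e = none ↔ ∀ k < ⌈(T : ℝ) / lam⌉₊,
      testInterval X ζ s (rightEnd lam s e (k + 1)) = none ∧
      testInterval X ζ (leftStart T lam s e (k + 1)) e = none := by
  simp only [firstDetection, expandingIntervals, List.findSome?_eq_none_iff, List.mem_flatMap,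
    List.mem_range, Option.map_eq_none_iff]
  constructor
  · intro h k hk
    exact ⟨h (Side.right, s, rightEnd lam s e (k + 1)) ⟨k, hk, by simp⟩,
      h (Side.left, leftStart T lam s e (k + 1), e) ⟨k, hk, by simp⟩⟩
  · rintro h x ⟨k, hk, hx⟩
    simp only [List.mem_cons, List.not_mem_nil, or_false] at hx
    rcases hx with rfl | rfl
    · exact (h k hk).1
    · exact (h k hk).2

/-- The first detection is made at the `(k + 1)`-st expansion on one side, and all earlier
expansions on the same side were negative. -/
lemma firstDetection_eq_some {d : ℕ} {X : ℕ → Fin d → ℝ} {T lam : ℕ} {ζ : ℝ} {s e : ℕ}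
    {sd : Side} {D : Detection} (h : firstDetection X T lam ζ s e = some (sd, D)) :
    ∃ k, (sd = Side.right ∧ D.left = s ∧ D.right = rightEnd lam s e (k + 1) ∧
        testInterval X ζ D.left D.right = some D.loc ∧
        ∀ k' < k, testInterval X ζ s (rightEnd lam s e (k' + 1)) = none) ∨
      (sd = Side.left ∧ D.left = leftStart T lam s e (k + 1) ∧ D.right = e ∧
        testInterval X ζ D.left D.right = some D.loc ∧
        ∀ k' < k, testInterval X ζ (leftStart T lam s e (k' + 1)) e = none) := by
  rw [firstDetection, expandingIntervals] at h
  generalize ⌈(T : ℝ) / lam⌉₊ = n at h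
  induction n with
  | zero => simp at h
  | succ n ih =>
    rw [List.range_succ, List.flatMap_append, List.findSome?_append, Option.or_eq_some_iff] at h
    rcases h with h | ⟨h0, h⟩
    · exact ih h
    · have h1 : ∀ k < n, testInterval X ζ s (rightEnd lam s e (k + 1)) = none ∧
          testInterval X ζ (leftStart T lam s e (k + 1)) e = none := by
        simp only [List.findSome?_eq_none_iff, List.mem_flatMap,
          List.mem_range, Option.map_eq_none_iff] at h0
        exact fun k hk => ⟨h0 (Side.right, s, rightEnd lam s e (k + 1)) ⟨k, hk, by simp⟩,
          h0 (Side.left, leftStart T lam s e (k + 1), e) ⟨k, hk, by simp⟩⟩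
      refine ⟨n, ?_⟩
      simp only [List.flatMap_cons, List.flatMap_nil, List.append_nil, List.findSome?_cons] at h
      cases hR : testInterval X ζ s (rightEnd lam s e (n + 1)) with
      | some b =>
        rw [hR] at h
        simp only [Option.map_some, Option.some.injEq, Prod.mk.injEq] at h
        obtain ⟨rfl, rfl⟩ := h
        exact Or.inl ⟨rfl, rfl, rfl, hR, fun k hk => (h1 k hk).1⟩
      | none =>
        rw [hR] at h
        cases hL : testInterval X ζ (leftStart T lam s e (n + 1)) e with
        | none => rw [hL] at h; simp at h
        | some b =>
          rw [hL] at h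
          simp only [Option.map_none, Option.map_some, Option.some.injEq, Prod.mk.injEq] at h
          obtain ⟨rfl, rfl⟩ := h
          exact Or.inr ⟨rfl, rfl, rfl, hL, fun k hk => (h1 k hk).2⟩

/-- What the search needs from the tests of single intervals. `K` is the distance from both ends at
which an isolated change-point is sure to be detected, and `Acc j D` says that the detection `D` is
accurate for the change-point `r j`. If `r i < a` and `c ≤ r (i + 2)`, then only
`r (i + 1)` can be a change-point inside `[a, c]`. The condition on the spacing leaves room for a
grid of step `lam` to hit every window at distance at least `K` from two consecutive change-points.
-/
structure ReliableTests {d : ℕ} (X : ℕ → Fin d → ℝ) (T N : ℕ) (r : ℕ → ℕ) (lam : ℕ) (ζ : ℝ)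
    (K : ℕ) (Acc : ℕ → Detection → Prop) : Prop where
  lam_pos : 0 < lam
  K_pos : 0 < K
  last : r (N + 1) = T
  spacing : ∀ k ≤ N, r k + (2 * K + lam) ≤ r (k + 1) + 1
  none_of_no_change : ∀ i ≤ N, ∀ a c, 1 ≤ a → r i ≤ a → c ≤ r (i + 1) → testInterval X ζ a c = none
  ne_none_of_change : ∀ i < N, ∀ a c, r i < a → a + K ≤ r (i + 1) → r (i + 1) + K ≤ c →
    c ≤ r (i + 2) → testInterval X ζ a c ≠ none
  accurate : ∀ i < N, ∀ a c b, r i < a → a < r (i + 1) → r (i + 1) < c → c ≤ r (i + 2) →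
    testInterval X ζ a c = some b → Acc (i + 1) ⟨b, a, c⟩

namespace ReliableTests

variable {d : ℕ} {X : ℕ → Fin d → ℝ} {T N : ℕ} {r : ℕ → ℕ} {lam : ℕ} {ζ : ℝ}
    {K : ℕ} {Acc : ℕ → Detection → Prop}

lemma mono (H : ReliableTests X T N r lam ζ K Acc) {i j : ℕ} (hij : i ≤ j) (hj : j ≤ N + 1) :
    r i ≤ r j := by
  induction j, hij using Nat.le_induction with
  | base => exact le_rfl
  | succ n hn ih =>
    have := H.spacing n (by omega)
    have := H.K_pos
    have := ih (by omega)
    omega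

/-- As long as the right-expanding intervals give no detection, their ends have not gone beyond `K`
points after the first change-point. -/
lemma right_lt (H : ReliableTests X T N r lam ζ K Acc) {i j s e : ℕ} (hij : i < j) (hj : j ≤ N)
    (hs : r i < s) (hsK : s + K ≤ r (i + 1)) (heK : r j + K ≤ e) (k : ℕ)
    (hk : ∀ k' < k, testInterval X ζ s (rightEnd lam s e (k' + 1)) = none) :
    (s / lam + k) * lam < r (i + 1) + K := by
  have := H.K_pos
  induction k with
  | zero =>
    have := Nat.div_mul_le_self s lam
    rw [add_zero]
    omega
  | succ k ih =>
    have h1 := ih fun k' hk' => hk k' (by omega)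
    by_contra! h2
    have h3 := hk k (by omega)
    have h4 : r (i + 1) + (2 * K + lam) ≤ r (i + 2) + 1 := H.spacing (i + 1) (by omega)
    have h5 := H.mono (show i + 1 ≤ j by omega) (by omega)
    have h6 : (s / lam + (k + 1)) * lam = (s / lam + k) * lam + lam := by ring
    refine H.ne_none_of_change i (by omega) s _ hs hsK ?_ ?_ h3
    · exact le_min h2 (by omega)
    · refine (min_le_left _ _).trans ?_
      omega

/-- As long as the left-expanding intervals give no detection, their starts have not gone beyond `K`
points before the last change-point. -/
lemma left_gt (H : ReliableTests X T N r lam ζ K Acc) {i j s e : ℕ} (hij : i < j) (hj : j ≤ N)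
    (hsK : s + K ≤ r (i + 1)) (heK : r j + K ≤ e) (he : e ≤ r (j + 1)) (k : ℕ)
    (hk : ∀ k' < k, testInterval X ζ (leftStart T lam s e (k' + 1)) e = none) :
    r j < T + 1 - ((T + 1 - e) / lam + k) * lam + K := by
  have := H.K_pos
  have heT : e ≤ T := by
    have := H.mono (show j + 1 ≤ N + 1 by omega) le_rfl
    rw [H.last] at this
    omega
  induction k with
  | zero =>
    have := Nat.div_mul_le_self (T + 1 - e) lam
    rw [add_zero]
    omega
  | succ k ih =>
    have h1 := ih fun k' hk' => hk k' (by omega)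
    by_contra! h2
    have h3 := hk k (by omega)
    obtain ⟨j, rfl⟩ := Nat.exists_eq_add_of_lt (Nat.pos_of_ne_zero (by omega : j ≠ 0))
    rw [zero_add] at *
    have h4 := H.spacing j (by omega)
    have h5 := H.mono (show i + 1 ≤ j + 1 by omega) (by omega)
    have h6 : ((T + 1 - e) / lam + (k + 1)) * lam = ((T + 1 - e) / lam + k) * lam + lam := by ring
    refine H.ne_none_of_change j (by omega) _ e ?_ ?_ heK he h3
    · refine lt_of_lt_of_le ?_ (le_max_left _ _)
      omega
    · rw [leftStart]
      omega

/-- When the change-points in `[s, e]` are `r (i + 1), …, r j`, all at distance at least `K` from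
the ends, the first detection belongs to `r (i + 1)` or to `r j`, and the remaining ones are again
at distance at least `K` from the ends of the interval in which the search restarts. -/
lemma firstDetection_of_change (H : ReliableTests X T N r lam ζ K Acc) {i j s e : ℕ}
    (hij : i < j) (hj : j ≤ N) (hs : r i < s) (hsK : s + K ≤ r (i + 1)) (heK : r j + K ≤ e)
    (he : e ≤ r (j + 1)) :
    (∃ D, firstDetection X T lam ζ s e = some (Side.right, D) ∧ Acc (i + 1) D ∧
      r (i + 1) < D.right ∧ D.right + K ≤ r (i + 2)) ∨
    (∃ D, firstDetection X T lam ζ s e = some (Side.left, D) ∧ Acc j D ∧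
      D.left ≤ r j ∧ (i + 1 < j → r (j - 1) + K ≤ D.left)) := by
  have hK := H.K_pos
  have heT : e ≤ T := by
    have := H.mono (show j + 1 ≤ N + 1 by omega) le_rfl
    rw [H.last] at this
    omega
  cases hf : firstDetection X T lam ζ s e with
  | none =>
    exfalso
    rw [firstDetection_eq_none_iff] at hf
    have h1 := H.right_lt hij hj hs hsK heK ⌈(T : ℝ) / lam⌉₊ fun k hk => (hf k hk).1
    have h2 : T ≤ ⌈(T : ℝ) / lam⌉₊ * lam := by
      have h3 := Nat.le_ceil ((T : ℝ) / lam)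
      rw [div_le_iff₀ (by exact_mod_cast H.lam_pos)] at h3
      exact_mod_cast h3
    have h4 := H.mono (show i + 1 ≤ j by omega) (by omega)
    rw [add_mul] at h1
    omega
  | some x =>
    obtain ⟨sd, D⟩ := x
    obtain ⟨k, ⟨rfl, h1, h2, h3, h4⟩ | ⟨rfl, h1, h2, h3, h4⟩⟩ := firstDetection_eq_some hf
    · refine Or.inl ⟨D, rfl, ?_⟩
      have h5 := H.right_lt hij hj hs hsK heK k h4
      have h6 : r (i + 1) + (2 * K + lam) ≤ r (i + 2) + 1 := H.spacing (i + 1) (by omega)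
      have h7 : (s / lam + (k + 1)) * lam = (s / lam + k) * lam + lam := by ring
      have h8 : D.right ≤ (s / lam + (k + 1)) * lam := h2 ▸ min_le_left _ _
      have h9 : r (i + 1) < D.right := by
        by_contra! h9
        rw [H.none_of_no_change i (by omega) _ _ (by omega) (by omega) h9] at h3
        simp at h3
      have h10 : D.right + K ≤ r (i + 2) := by
        omega
      exact ⟨H.accurate i (by omega) _ _ _ (by omega) (by omega) h9 (by omega) h3, h9, h10⟩
    · refine Or.inr ⟨D, rfl, ?_⟩
      have h5 := H.left_gt hij hj hsK heK he k h4
      obtain ⟨j, rfl⟩ := Nat.exists_eq_add_of_lt (Nat.pos_of_ne_zero (by omega : j ≠ 0))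
      rw [zero_add] at *
      have h6 := H.spacing j (by omega)
      have h7 : ((T + 1 - e) / lam + (k + 1)) * lam = ((T + 1 - e) / lam + k) * lam + lam := by ring
      have h8 : T + 1 - ((T + 1 - e) / lam + (k + 1)) * lam ≤ D.left := h1 ▸ le_max_left _ _
      have h9 : D.left < r (j + 1) := by
        by_contra! h9
        rw [H.none_of_no_change (j + 1) (by omega) _ _ (by omega) h9 (by omega)] at h3
        simp at h3
      have h10 : r j + K ≤ D.left := by omega
      refine ⟨H.accurate j (by omega) _ _ _ (by omega) h9 (by omega)
        (show D.right ≤ r (j + 1 + 1) by omega) h3, h9.le,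
        fun _ => h10⟩

/-- The detections in `[s, e]` correspond in order to the change-points `r (i + 1), …, r j`. The
distances from the ends are assumed only if there is a change-point left. -/
theorem forall₂_midAux (H : ReliableTests X T N r lam ζ K Acc) (n : ℕ) {i j s e : ℕ}
    (hij : i ≤ j) (hj : j ≤ N) (hn : j ≤ i + n) (hs : r i < s) (he : e ≤ r (j + 1))
    (hc : i < j → s + K ≤ r (i + 1) ∧ r j + K ≤ e) :
    List.Forall₂ Acc (List.range' (i + 1) (j - i)) (midAux X T lam ζ n s e) := by
  induction n generalizing i j s e with
  | zero =>
    obtain rfl : i = j := by omega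
    simp [midAux]
  | succ n ih =>
    rcases hij.eq_or_lt with rfl | hlt
    · have h : firstDetection X T lam ζ s e = none := by
        refine (firstDetection_eq_none_iff ..).2 fun k _ => ⟨?_, ?_⟩
        · exact H.none_of_no_change i hj _ _ (by omega) hs.le ((min_le_right _ _).trans he)
        · have : s ≤ leftStart T lam s e (k + 1) := le_max_right _ _
          exact H.none_of_no_change i hj _ _ (by omega) (by omega) he
      simp [midAux, h]
    · obtain ⟨hsK, heK⟩ := hc hlt
      obtain ⟨D, hD, hacc, h1, h2⟩ | ⟨D, hD, hacc, h1, h2⟩ :=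
        H.firstDetection_of_change hlt hj hs hsK heK he
      · have h3 := ih (i := i + 1) (j := j) (s := D.right) (e := e) hlt hj (by omega) h1 he
          fun _ => ⟨h2, heK⟩
        simp only [midAux, hD]
        rw [show j - i = j - (i + 1) + 1 by omega, List.range'_succ]
        exact List.Forall₂.cons hacc h3
      · obtain ⟨j, rfl⟩ := Nat.exists_eq_add_of_lt hlt
        have h3 := ih (i := i) (j := i + j) (s := s) (e := D.left) (by omega) (by omega) (by omega)
          hs h1 fun h => ⟨hsK, h2 (by omega)⟩
        simp only [midAux, hD]
        rw [show i + j + 1 - i = i + j - i + 1 by omega, List.range'_1_concat]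
        refine List.rel_append h3 (List.Forall₂.cons ?_ List.Forall₂.nil)
        rwa [show i + 1 + (i + j - i) = i + j + 1 by omega]

lemma le_last (H : ReliableTests X T N r lam ζ K Acc) {j : ℕ} (hj : j ≤ N + 1) : j ≤ r j := by
  induction j with
  | zero => exact Nat.zero_le _
  | succ j ih =>
    have := H.spacing j (by omega)
    have := H.K_pos
    have := H.lam_pos
    have := ih (by omega)
    omega

theorem forall₂_mid (H : ReliableTests X T N r lam ζ K Acc) (hr : r 0 = 0) :
    List.Forall₂ Acc (List.range' 1 N) (mid X T lam ζ) := by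
  have h0 := H.le_last le_rfl
  have h1 := H.spacing 0 (Nat.zero_le _)
  have h2 := H.spacing N le_rfl
  have h3 := H.last
  have := H.K_pos
  have := H.lam_pos
  refine H.forall₂_midAux T (Nat.zero_le _) le_rfl (by omega) (by omega) (by omega) fun _ => ?_
  rw [zero_add] at h1 ⊢
  constructor <;> omega

end ReliableTests

/-! ### The noise -/

section Noise

variable {Ω : Type*} [MeasurableSpace Ω] {P : Measure Ω}

lemma map_eval_stdGaussian {d : ℕ} (q : Fin d) :
    (stdGaussian (EuclideanSpace ℝ (Fin d))).map (fun x => x q) = gaussianReal 0 1 := by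
  rw [← map_pi_eq_stdGaussian, Measure.map_map (by fun_prop) (by fun_prop)]
  exact (measurePreserving_eval (fun _ : Fin d => gaussianReal 0 1) q).map_eq

lemma hasSubgaussianMGF_coord {d : ℕ} {Y : Ω → EuclideanSpace ℝ (Fin d)}
    (hY : HasLaw Y (stdGaussian (EuclideanSpace ℝ (Fin d))) P) (q : Fin d) :
    HasSubgaussianMGF (fun ω => Y ω q) 1 P := by
  have hmap : P.map (fun ω => Y ω q) = gaussianReal 0 1 := by
    rw [← map_eval_stdGaussian q, ← hY.map_eq,
      AEMeasurable.map_map_of_aemeasurable (by fun_prop) hY.aemeasurable]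
    rfl
  have hm : AEMeasurable (fun ω => Y ω q) P :=
    (by fun_prop : Measurable fun x : EuclideanSpace ℝ (Fin d) => x q).comp_aemeasurable
      hY.aemeasurable
  refine ⟨fun t => ?_, fun t => ?_⟩
  · have h := integrable_exp_mul_gaussianReal (μ := 0) (v := 1) t
    rw [← hmap] at h
    exact h.comp_aemeasurable hm
  · rw [mgf_gaussianReal hmap]
    simp

/-- Gaussian tail bound for one component of the noise and one direction `v` of norm at most `1`. -/
lemma measureReal_lt_abs_sum_le [IsProbabilityMeasure P] {d T : ℕ}
    {noise : ℕ → Ω → EuclideanSpace ℝ (Fin d)}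
    (hlaw : ∀ t ∈ Finset.Icc 1 T, HasLaw (noise t) (stdGaussian (EuclideanSpace ℝ (Fin d))) P)
    (hindep : iIndepFun (fun t : Finset.Icc 1 T => noise t) P) (q : Fin d) (v : ℕ → ℝ)
    (hv : ∑ t ∈ Finset.Icc 1 T, v t ^ 2 ≤ 1) {x : ℝ} (hx : 0 ≤ x) :
    P.real {ω | x < |∑ t ∈ Finset.Icc 1 T, noise t ω q * v t|} ≤ 2 * Real.exp (-x ^ 2 / 2) := by
  have hind : iIndepFun (fun (t : Finset.Icc 1 T) ω => v t * noise t ω q) P :=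
    hindep.comp (fun t y => v t * y q) fun t => by fun_prop
  have hsub := HasSubgaussianMGF.sum_of_iIndepFun hind (s := Finset.univ) fun t _ =>
    (hasSubgaussianMGF_coord (hlaw t t.2) q).const_mul (v t)
  have hsub1 : HasSubgaussianMGF (fun ω => ∑ t ∈ Finset.Icc 1 T, noise t ω q * v t) 1 P := by
    have hfun : (fun ω => ∑ t ∈ Finset.Icc 1 T, noise t ω q * v t) =
        fun ω => ∑ t : Finset.Icc 1 T, v t * noise t ω q := by
      ext ω
      rw [← Finset.sum_coe_sort]
      exact Finset.sum_congr rfl fun t _ => mul_comm _ _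
    rw [hfun]
    -- the variance proxy is raised to `1`: `v` may be `0`, and the tail bound divides by the proxy
    refine ⟨hsub.integrable_exp_mul, fun t => (hsub.mgf_le t).trans ?_⟩
    gcongr
    rw [← NNReal.coe_le_coe]
    rw [NNReal.coe_sum]
    refine le_trans (le_of_eq ?_) hv
    exact (Finset.sum_congr rfl fun (t : Finset.Icc 1 T) _ => mul_one (v t ^ 2)).trans
      (Finset.sum_coe_sort (Finset.Icc 1 T) fun t => v t ^ 2)
  have h1 := hsub1.measure_ge_le hx
  have h2 := hsub1.neg.measure_ge_le hx
  have hsubset : {ω | x < |∑ t ∈ Finset.Icc 1 T, noise t ω q * v t|} ⊆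
      {ω | x ≤ ∑ t ∈ Finset.Icc 1 T, noise t ω q * v t} ∪
      {ω | x ≤ (-fun ω => ∑ t ∈ Finset.Icc 1 T, noise t ω q * v t) ω} := by
    intro ω hω
    rcases lt_abs.1 (Set.mem_ofPred.1 hω) with h | h
    · exact Or.inl h.le
    · exact Or.inr h.le
  refine (measureReal_mono hsubset).trans ((measureReal_union_le _ _).trans ?_)
  simp only [NNReal.coe_one, mul_one] at h1 h2
  linarith

lemma measureReal_exists_lt_abs_sum_le [IsProbabilityMeasure P] {d T : ℕ}
    {noise : ℕ → Ω → EuclideanSpace ℝ (Fin d)}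
    (hlaw : ∀ t ∈ Finset.Icc 1 T, HasLaw (noise t) (stdGaussian (EuclideanSpace ℝ (Fin d))) P)
    (hindep : iIndepFun (fun t : Finset.Icc 1 T => noise t) P) {ι : Type*} (I : Finset ι)
    (v : ι → ℕ → ℝ) (hv : ∀ i ∈ I, ∑ t ∈ Finset.Icc 1 T, v i t ^ 2 ≤ 1) {x : ℝ} (hx : 0 ≤ x) :
    P.real {ω | ∃ i ∈ I, ∃ q, x < |∑ t ∈ Finset.Icc 1 T, noise t ω q * v i t|} ≤
      (I.card * d) * (2 * Real.exp (-x ^ 2 / 2)) := by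
  have h : {ω | ∃ i ∈ I, ∃ q, x < |∑ t ∈ Finset.Icc 1 T, noise t ω q * v i t|} =
      ⋃ p ∈ I ×ˢ (Finset.univ : Finset (Fin d)),
        {ω | x < |∑ t ∈ Finset.Icc 1 T, noise t ω p.2 * v p.1 t|} := by
    ext ω
    simp
  rw [h]
  refine (measureReal_biUnion_finset_le _ _).trans ?_
  refine (Finset.sum_le_card_nsmul _ _ _ fun p hp => measureReal_lt_abs_sum_le hlaw hindep p.2
    (v p.1) (hv _ (Finset.mem_product.1 hp).1) hx).trans ?_
  rw [Finset.card_product, Finset.card_univ, Fintype.card_fin, nsmul_eq_mul]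
  push_cast
  rfl

end Noise

lemma contrastVec_of_notMem {s e b t : ℕ} (hb : s ≤ b) (he : b ≤ e) (ht : t ∉ Finset.Icc s e) :
    contrastVec s e b t = 0 := by
  rw [Finset.mem_Icc] at ht
  rw [contrastVec, if_neg (by omega), if_neg (by omega)]

/-- The directions in which the noise has to be controlled: the normalised residual, and for
`b = r`, where the residual is `0`, the contrast vector. If the residual vanishes for `b ≠ r`, division
by zero makes the vector `0`. -/
noncomputable def testVec (s e b r t : ℕ) : ℝ :=
  if b = r then contrastVec s e b t
  else residualVec s e b r t / √(1 - contrastCorr s e b r ^ 2)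

lemma testVec_of_notMem {s e b r t : ℕ} (hb : s ≤ b) (he : b ≤ e) (hr : s ≤ r) (hre : r ≤ e)
    (ht : t ∉ Finset.Icc s e) : testVec s e b r t = 0 := by
  rw [testVec, residualVec, contrastVec_of_notMem hb he ht, contrastVec_of_notMem hr hre ht]
  simp

lemma sum_testVec_sq_le {s e b r : ℕ} (hb : s < b) (he : b < e) (hr : s < r) (hre : r < e) :
    ∑ t ∈ Finset.Icc s e, testVec s e b r t ^ 2 ≤ 1 := by
  by_cases h : b = r
  · simp only [testVec, if_pos h]
    exact (sum_contrastVec_sq hb he).le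
  · simp only [testVec, if_neg h, div_pow]
    rw [← Finset.sum_div, sum_residualVec_sq hb he hr hre,
      Real.sq_sqrt (one_sub_contrastCorr_sq_nonneg hb he hr hre)]
    exact div_self_le_one _

lemma sum_mul_testVec {T s e b r : ℕ} (hs : 1 ≤ s) (hb : s < b) (he : b < e) (hr : s < r)
    (hre : r < e) (heT : e ≤ T) (z : ℕ → ℝ) :
    ∑ t ∈ Finset.Icc 1 T, z t * testVec s e b r t =
      ∑ t ∈ Finset.Icc s e, z t * testVec s e b r t := by
  refine (Finset.sum_subset (Finset.Icc_subset_Icc hs heT) fun t _ ht => ?_).symm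
  rw [testVec_of_notMem hb.le he.le hr.le hre.le ht, mul_zero]

lemma residualVec_eq_mul_testVec {s e b r t : ℕ} (hb : s < b) (he : b < e) (hr : s < r)
    (hre : r < e) (hbr : b ≠ r) (ht : t ∈ Finset.Icc s e) :
    residualVec s e b r t = √(1 - contrastCorr s e b r ^ 2) * testVec s e b r t := by
  rw [testVec, if_neg hbr]
  by_cases h : √(1 - contrastCorr s e b r ^ 2) = 0
  · rw [h, zero_mul]
    have h1 := sum_residualVec_sq hb he hr hre
    rw [← Real.sq_sqrt (one_sub_contrastCorr_sq_nonneg hb he hr hre), h, zero_pow two_ne_zero,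
      Finset.sum_eq_zero_iff_of_nonneg fun t _ => sq_nonneg _] at h1
    exact pow_eq_zero_iff two_ne_zero |>.1 (h1 t ht)
  · field_simp

lemma noiseBound_of_testVec {T : ℕ} {z : ℕ → ℝ} {L : ℝ} (hL : 0 ≤ L)
    (h : ∀ s b r e, 1 ≤ s → s < b → b < e → s < r → r < e → e ≤ T →
      |∑ t ∈ Finset.Icc 1 T, z t * testVec s e b r t| ≤ L) : NoiseBound T z L where
  contrast_le s b e hs hb he heT := by
    have := h s b b e hs hb he hb he heT
    rw [sum_mul_testVec hs hb he hb he heT] at this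
    simpa [testVec, contrast] using this
  residual_le s b r e hs hb he hr hre heT := by
    by_cases hbr : b = r
    · subst hbr
      have : ∀ t, residualVec s e b b t = 0 := fun t => by
        rw [residualVec, contrastCorr_self hb he]; ring
      simp only [this, mul_zero, Finset.sum_const_zero, abs_zero]
      positivity
    · have h1 := h s b r e hs hb he hr hre heT
      rw [sum_mul_testVec hs hb he hr hre heT] at h1
      rw [Finset.sum_congr rfl fun t ht => by
        rw [residualVec_eq_mul_testVec hb he hr hre hbr ht, mul_left_comm], ← Finset.mul_sum,
        abs_mul, abs_of_nonneg (Real.sqrt_nonneg _), mul_comm]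
      exact mul_le_mul_of_nonneg_right h1 (Real.sqrt_nonneg _)

lemma logTd_nonneg {T d : ℕ} (hT : 0 < T) (hd : 0 < d) : 0 ≤ logTd T d := by
  have h1 : (1 : ℝ) ≤ T := by exact_mod_cast hT
  have h2 : (1 : ℝ) ≤ d := by exact_mod_cast hd
  exact Real.log_nonneg (one_le_mul_of_one_le_of_one_le h1 (Real.one_le_rpow h2 (by norm_num)))

/-- The union bound over `T ^ 4` directions and `d` components; `T ^ 4 * d` is the fourth power of
`T * d ^ (1 / 4)`. -/
lemma card_mul_exp_le {T d : ℕ} (hT : 0 < T) (hd : 0 < d) :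
    (T : ℝ) ^ 4 * d * (2 * Real.exp (-(4 * √(logTd T d)) ^ 2 / 2)) ≤ 2 / T := by
  have h1 : (1 : ℝ) ≤ T := by exact_mod_cast hT
  have h2 : (1 : ℝ) ≤ d := by exact_mod_cast hd
  have h3 : 1 ≤ (d : ℝ) ^ (1 / 4 : ℝ) := Real.one_le_rpow h2 (by norm_num)
  have h4 : ((d : ℝ) ^ (1 / 4 : ℝ)) ^ 4 = d := by
    rw [← Real.rpow_natCast, ← Real.rpow_mul (by positivity)]; norm_num
  rw [mul_pow, Real.sq_sqrt (logTd_nonneg hT hd), logTd]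
  have h5 : (T : ℝ) ^ 4 * d = (T * (d : ℝ) ^ (1 / 4 : ℝ)) ^ 4 := by rw [mul_pow, h4]
  have h6 : (T : ℝ) ≤ T * (d : ℝ) ^ (1 / 4 : ℝ) := le_mul_of_one_le_right (by linarith) h3
  rw [h5]
  generalize (T : ℝ) * (d : ℝ) ^ (1 / 4 : ℝ) = y at *
  have hy : 1 ≤ y := h1.trans h6
  have h7 : Real.exp (-(4 ^ 2 * Real.log y) / 2) ≤ (y ^ 5)⁻¹ := by
    rw [← Real.exp_log (show 0 < (y ^ 5)⁻¹ by positivity), Real.exp_le_exp, Real.log_inv,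
      Real.log_pow]
    have := Real.log_nonneg hy
    push_cast
    linarith
  calc y ^ 4 * (2 * Real.exp (-(4 ^ 2 * Real.log y) / 2)) ≤ y ^ 4 * (2 * (y ^ 5)⁻¹) := by gcongr
    _ = 2 / y := by field_simp
    _ ≤ 2 / T := by gcongr

theorem one_sub_le_measureReal_noiseBound {Ω : Type*} [MeasurableSpace Ω] {P : Measure Ω}
    [IsProbabilityMeasure P] {d T : ℕ} (hT : 0 < T) (hd : 0 < d) {σmax : ℝ} {σ : Fin d → ℝ}
    (hσ : ∀ q, |σ q| ≤ σmax) {noise : ℕ → Ω → EuclideanSpace ℝ (Fin d)}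
    (hlaw : ∀ t ∈ Finset.Icc 1 T, HasLaw (noise t) (stdGaussian (EuclideanSpace ℝ (Fin d))) P)
    (hindep : iIndepFun (fun t : Finset.Icc 1 T => noise t) P) :
    1 - 2 / T ≤ P.real {ω | ∀ q,
      NoiseBound T (fun t => σ q * noise t ω q) (σmax * (4 * √(logTd T d)))} := by
  classical
  let I : Finset (ℕ × ℕ × ℕ × ℕ) :=
    (Finset.Icc 1 T ×ˢ Finset.Icc 1 T ×ˢ Finset.Icc 1 T ×ˢ Finset.Icc 1 T).filter
      fun p => p.1 < p.2.1 ∧ p.2.1 < p.2.2.2 ∧ p.1 < p.2.2.1 ∧ p.2.2.1 < p.2.2.2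
  have hI : (I.card : ℝ) ≤ (T : ℝ) ^ 4 := by
    have : I.card ≤ T ^ 4 := (Finset.card_filter_le _ _).trans (by
      simp only [Finset.card_product, Nat.card_Icc, Nat.add_sub_cancel]
      exact le_of_eq (by ring))
    exact_mod_cast this
  have hbad := measureReal_exists_lt_abs_sum_le hlaw hindep I
    (fun p => testVec p.1 p.2.2.2 p.2.1 p.2.2.1) (fun p hp => by
      simp only [I, Finset.mem_filter, Finset.mem_product, Finset.mem_Icc] at hp
      obtain ⟨⟨h1, -, -, h2⟩, h3, h4, h5, h6⟩ := hp
      refine le_trans (le_of_eq ?_) (sum_testVec_sq_le h3 h4 h5 h6)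
      refine (Finset.sum_subset (Finset.Icc_subset_Icc h1.1 h2.2) fun t _ ht => ?_).symm
      rw [testVec_of_notMem h3.le h4.le h5.le h6.le ht, zero_pow two_ne_zero])
    (x := 4 * √(logTd T d)) (by positivity)
  have hbad' := hbad.trans ((mul_le_mul_of_nonneg_right
    (mul_le_mul_of_nonneg_right hI (Nat.cast_nonneg d)) (by positivity)).trans
    (card_mul_exp_le hT hd))
  set B := {ω | ∃ i ∈ I, ∃ q, 4 * √(logTd T d) <
    |∑ t ∈ Finset.Icc 1 T, noise t ω q * testVec i.1 i.2.2.2 i.2.1 i.2.2.1 t|}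
  set G := {ω | ∀ q, NoiseBound T (fun t => σ q * noise t ω q) (σmax * (4 * √(logTd T d)))}
  have hcover : Set.univ ⊆ G ∪ B := by
    intro ω _
    by_contra hω
    rw [Set.mem_union, not_or] at hω
    refine hω.1 fun q => noiseBound_of_testVec ?_ fun s b r e hs hb he hr hre heT => ?_
    · exact mul_nonneg ((abs_nonneg _).trans (hσ q)) (by positivity)
    · have h1 : |∑ t ∈ Finset.Icc 1 T, noise t ω q * testVec s e b r t| ≤ 4 * √(logTd T d) := by
        by_contra! h
        refine hω.2 ⟨(s, b, r, e), ?_, q, h⟩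
        simp only [I, Finset.mem_filter, Finset.mem_product, Finset.mem_Icc]
        omega
      simp only [mul_assoc, ← Finset.mul_sum]
      rw [abs_mul]
      exact mul_le_mul (hσ q) h1 (abs_nonneg _) ((abs_nonneg _).trans (hσ q))
  have h1 := measureReal_mono (μ := P) hcover
  rw [probReal_univ] at h1
  have h2 := h1.trans (measureReal_union_le G B)
  linarith

/-! ### Tests of single intervals -/

lemma contrast_le_aggContrast {d : ℕ} (X : ℕ → Fin d → ℝ) (s e b : ℕ) (q : Fin d) :
    contrast s e b (fun t => X t q) ≤ aggContrast X s e b :=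
  le_ciSup (f := fun q => contrast s e b fun t => X t q) (Set.finite_range _).bddAbove q

lemma testInterval_eq_some {d : ℕ} {X : ℕ → Fin d → ℝ} {ζ : ℝ} {a c b : ℕ}
    (h : testInterval X ζ a c = some b) :
    a < b ∧ b < c ∧ ζ < aggContrast X a c b ∧
      ∀ b', a < b' → b' < c → aggContrast X a c b' ≤ aggContrast X a c b := by
  rw [testInterval, Option.filter_eq_some_iff, decide_eq_true_eq] at h
  obtain ⟨h1, h2⟩ := h
  have h3 := List.mem_range'_1.1 (List.argmax_mem h1)
  exact ⟨by omega, by omega, h2,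
    fun b' hb hc => List.le_of_mem_argmax (List.mem_range'_1.2 (by omega)) h1⟩

lemma testInterval_eq_none {d : ℕ} {X : ℕ → Fin d → ℝ} {ζ : ℝ} {a c : ℕ}
    (h : ∀ b, a < b → b < c → aggContrast X a c b ≤ ζ) : testInterval X ζ a c = none := by
  rw [Option.eq_none_iff_forall_ne_some]
  intro b hb
  obtain ⟨h1, h2, h3, -⟩ := testInterval_eq_some hb
  exact (h b h1 h2).not_gt h3

lemma testInterval_ne_none {d : ℕ} {X : ℕ → Fin d → ℝ} {ζ : ℝ} {a c b : ℕ} (ha : a < b)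
    (hc : b < c) (h : ζ < aggContrast X a c b) : testInterval X ζ a c ≠ none := by
  have hb : b ∈ List.range' (a + 1) (c - a - 1) := List.mem_range'_1.2 (by omega)
  rw [testInterval]
  cases h1 : (List.range' (a + 1) (c - a - 1)).argmax (aggContrast X a c) with
  | none =>
    rw [List.argmax_eq_none] at h1
    simp [h1] at hb
  | some b' =>
    have h2 := h.trans_le (List.le_of_mem_argmax hb h1)
    simp [Option.filter, h2]

/-! ### The signal -/

namespace IsPiecewiseLinearSignal

variable {T d N : ℕ} {r : ℕ → ℕ} {f : ℕ → Fin d → ℝ}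

/-- Continuity lets the affine formula of a segment hold at the preceding change-point as well. -/
lemma exists_affine (H : IsPiecewiseLinearSignal T d N r f) :
    ∃ μ₁ μ₂ : ℕ → Fin d → ℝ,
      (∀ i ≤ N, ∀ t, 1 ≤ t → r i ≤ t → t ≤ r (i + 1) → ∀ q,
        f t q = μ₁ (i + 1) q + μ₂ (i + 1) q * t) := by
  obtain ⟨μ₁, μ₂, h1, h2⟩ := H.linear
  refine ⟨μ₁, μ₂, fun i hi t ht hit hti q => ?_⟩
  rcases hit.lt_or_eq with h | h
  · exact h1 (i + 1) (by simp; omega) t (by simp; omega) q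
  · obtain ⟨i, rfl⟩ := Nat.exists_eq_add_of_lt (Nat.pos_of_ne_zero (n := i) (by
      rintro rfl
      rw [H.zero] at h
      omega))
    rw [zero_add] at *
    have h3 := H.increasing i (by omega)
    rw [← h, h1 (i + 1) (by simp; omega) _ (by simp; omega) q]
    exact h2 (i + 1) (by simp; omega) q

lemma exists_kink (H : IsPiecewiseLinearSignal T d N r f) {i : ℕ} (hi : i < N)
    (hsp : r i + 2 ≤ r (i + 1)) (q : Fin d) :
    ∃ a c D : ℝ, (∀ t, 1 ≤ t → r i ≤ t → t ≤ r (i + 2) →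
      f t q = a + c * t + D * hinge (r (i + 1)) t) ∧ |D| = slopeChange f (r (i + 1)) q := by
  obtain ⟨μ₁, μ₂, h⟩ := H.exists_affine
  have h1 := h i hi.le
  have h2 := h (i + 1) hi
  have h3 : r (i + 1) < r (i + 2) := H.increasing (i + 1) hi
  have h4 : μ₁ (i + 1) q + μ₂ (i + 1) q * r (i + 1) =
      μ₁ (i + 2) q + μ₂ (i + 2) q * r (i + 1) := by
    rw [← h1 (r (i + 1)) (by omega) (by omega) le_rfl q,
      h2 (r (i + 1)) (by omega) le_rfl h3.le q]
  have h5 : ∀ t, 1 ≤ t → r i ≤ t → t ≤ r (i + 2) → f t q = μ₁ (i + 1) q + μ₂ (i + 1) q * t +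
      (μ₂ (i + 2) q - μ₂ (i + 1) q) * hinge (r (i + 1)) t := by
    intro t ht hit hti
    rcases le_total t (r (i + 1)) with h | h
    · rw [h1 t ht hit h, hinge, Nat.sub_eq_zero_of_le h]
      simp
    · rw [h2 t ht h hti, hinge, Nat.cast_sub h]
      linear_combination -h4
  refine ⟨_, _, _, h5, ?_⟩
  rw [slopeChange, h5 _ (by omega) (by omega) (by omega : r (i + 1) - 1 ≤ r (i + 2)),
    h5 _ (by omega) (by omega) (by omega : r (i + 1) + 1 ≤ r (i + 2)),
    h5 _ (by omega) (by omega) h3.le, hinge, hinge, hinge,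
    Nat.sub_eq_zero_of_le (Nat.sub_le _ _), Nat.sub_self, Nat.add_sub_cancel_left,
    Nat.cast_sub (by omega)]
  congr 1
  push_cast
  ring

end IsPiecewiseLinearSignal

lemma minSpacing_le {N : ℕ} (r : ℕ → ℕ) {k : ℕ} (hk : k ≤ N) :
    minSpacing N r ≤ r (k + 1) - r k :=
  Finset.inf'_le _ (Finset.mem_range.2 (by omega))

lemma exists_signalStrength_le {d N : ℕ} (hd : 0 < d) (r : ℕ → ℕ) (f : ℕ → Fin d → ℝ) {i : ℕ}
    (hi : i < N) :
    ∃ q, signalStrength N r f ≤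
      ENNReal.ofReal (√((minSpacing N r : ℝ) ^ 3) * slopeChange f (r (i + 1)) q) := by
  have : Nonempty (Fin d) := ⟨⟨0, hd⟩⟩
  obtain ⟨q, hq⟩ := exists_eq_ciSup_of_finite
    (f := fun q => ENNReal.ofReal (slopeChange f (r (i + 1)) q))
  refine ⟨q, ?_⟩
  have h1 : minMagnitude N r f ≤ ENNReal.ofReal (slopeChange f (r (i + 1)) q) := by
    rw [hq]
    exact iInf₂_le (i + 1) (by simp; omega)
  have h2 : (minSpacing N r : ℝ≥0∞) ^ (3 / 2 : ℝ) =
      ENNReal.ofReal (√((minSpacing N r : ℝ) ^ 3)) := by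
    rw [← ENNReal.ofReal_natCast, ENNReal.ofReal_rpow_of_nonneg (by positivity) (by norm_num),
      Real.sqrt_eq_rpow, ← Real.rpow_natCast, ← Real.rpow_mul (by positivity)]
    norm_num
  rw [signalStrength, h2, ENNReal.ofReal_mul (Real.sqrt_nonneg _)]
  gcongr

lemma mul_rpow_two_thirds_le {x y B : ℝ} (hx : 0 ≤ x) (hy : 0 ≤ y) (h : x ^ 3 * y ^ 2 ≤ B) :
    x * y ^ (2 / 3 : ℝ) ≤ B ^ (1 / 3 : ℝ) := by
  have h1 : x * y ^ (2 / 3 : ℝ) = (x ^ 3 * y ^ 2) ^ (1 / 3 : ℝ) := by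
    rw [Real.mul_rpow (by positivity) (by positivity), ← Real.rpow_natCast x,
      ← Real.rpow_natCast y, ← Real.rpow_mul hx, ← Real.rpow_mul hy]
    norm_num
  rw [h1]
  exact Real.rpow_le_rpow (by positivity) h (by norm_num)

/-! ### Accuracy on the event of bounded noise -/

/-- The deterministic part of the theorem. The number `(1 - 1 / m) / 2` is the fraction of the
minimum spacing up to which every change-point is isolated, and `η` times `δ ^ (3/2) Δ` is the
resulting lower bound for the contrast. -/
theorem isAccurate_mid {σmax m : ℝ} (hσmax : 0 < σmax) (hm : 1 < m) {η : ℝ}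
    (hη : η = √(((1 - 1 / m) / 2) ^ 3) / 5) {T d N : ℕ} {r : ℕ → ℕ} {f : ℕ → Fin d → ℝ}
    {X : ℕ → Fin d → ℝ} {lam : ℕ} {ζ : ℝ} (hd : 0 < d) (H : IsPiecewiseLinearSignal T d N r f)
    (hlam : 0 < lam) (hmlam : m * lam ≤ minSpacing N r)
    (hA2 : ENNReal.ofReal (256 * σmax / η * √(logTd T d)) ≤ signalStrength N r f)
    (hζ : 64 * σmax * √(logTd T d) ≤ ζ)
    (hζ' : ENNReal.ofReal ζ < ENNReal.ofReal (η / 2) * signalStrength N r f)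
    (hX : ∀ q, NoiseBound T (fun t => X t q - f t q) (σmax * (4 * √(logTd T d)))) :
    IsAccurate N r f X ((3456 * σmax ^ 2) ^ (1 / 3 : ℝ) * logTd T d ^ (1 / 3 : ℝ))
      (mid X T lam ζ) := by
  have hN := H.increasing N le_rfl
  rw [H.last] at hN
  have : Nonempty (Fin d) := ⟨⟨0, hd⟩⟩
  have hlog := logTd_nonneg (T := T) (d := d) (by omega) hd
  have hη0 : 0 < η := by
    have : 0 < 1 - 1 / m := by
      rw [sub_pos, div_lt_one (by linarith)]; exact hm
    rw [hη]; positivity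
  set L := σmax * (4 * √(logTd T d)) with hLdef
  have hL0 : 0 ≤ L := by positivity
  have hL2 : L ^ 2 = 16 * σmax ^ 2 * logTd T d := by
    rw [hLdef, mul_pow, mul_pow, Real.sq_sqrt hlog]; ring
  have hLζ : 16 * L ≤ ζ := by rw [hLdef]; linarith
  set δ := minSpacing N r with hδ
  have hlamδ : lam < δ := by
    have : (0 : ℝ) < lam := by exact_mod_cast hlam
    have : (lam : ℝ) < δ := by nlinarith
    exact_mod_cast this
  have hsp : ∀ k ≤ N, r k + δ ≤ r (k + 1) := fun k hk => by
    have h1 := minSpacing_le r hk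
    have h2 := H.increasing k hk
    omega
  have hmono : ∀ i j, i ≤ j → j ≤ N + 1 → r i ≤ r j := fun i j hij => by
    induction j, hij using Nat.le_induction with
    | base => exact fun _ => le_rfl
    | succ n hn ih =>
      intro hj
      exact (ih (by omega)).trans (H.increasing n (by omega)).le
  have hrT : ∀ i ≤ N, r (i + 1) ≤ T := fun i hi =>
    (hmono (i + 1) (N + 1) (by omega) le_rfl).trans_eq H.last
  -- the largest `K` for which a grid of step `lam` meets every window between two change-points
  obtain ⟨K, hK⟩ : ∃ K, K = (δ + 1 - lam) / 2 := ⟨_, rfl⟩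
  have hKδ : (1 - 1 / m) / 2 * δ ≤ K := by
    have h1 : δ ≤ 2 * K + lam := by omega
    have h2 : (δ : ℝ) ≤ 2 * K + lam := by exact_mod_cast h1
    have h3 : (lam : ℝ) ≤ 1 / m * δ := by
      rw [one_div_mul_eq_div, le_div_iff₀ (by linarith)]; linarith
    linarith
  let Acc : ℕ → Detection → Prop := fun j D => ∀ q, IsMaxComponent X D q →
    |(D.loc : ℝ) - r j| * slopeChange f (r j) q ^ (2 / 3 : ℝ) ≤
      (3456 * σmax ^ 2) ^ (1 / 3 : ℝ) * logTd T d ^ (1 / 3 : ℝ)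
  have hrel : ReliableTests X T N r lam ζ K Acc := by
    refine ⟨hlam, by omega, H.last, fun k hk => ?_, fun i hi a c ha hia hci => ?_,
      fun i hi a c hia haK hKc hci => ?_, fun i hi a c b hia har hrc hci hb q hq => ?_⟩
    · have := hsp k hk
      omega
    · obtain ⟨μ₁, μ₂, hμ⟩ := H.exists_affine
      refine testInterval_eq_none fun b hab hbc => ciSup_le fun q => ?_
      have hcT := hrT i hi
      have := contrast_linear_le (hX q) ha hab hbc (by omega) (x := fun t => X t q)
        (a := μ₁ (i + 1) q) (c := μ₂ (i + 1) q) fun t ht => by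
          rw [Finset.mem_Icc] at ht
          rw [← hμ i hi t (by omega) (by omega) (by omega) q]; ring
      linarith
    · obtain ⟨q, hq⟩ := exists_signalStrength_le hd r f hi
      obtain ⟨a', c', D, hf, hD⟩ := H.exists_kink hi (by have := hsp i hi.le; omega) q
      have hcT := hrT (i + 1) hi
      have h1 := le_contrast_of_kink (hX q) (s := a) (r := r (i + 1)) (e := c) (k := K) (by omega)
        (by omega) haK hKc (hci.trans hcT) (x := fun t => X t q) (a := a') (c := c') (D := D)
        fun t ht => by
          rw [Finset.mem_Icc] at ht
          rw [← hf t (by omega) (by omega) (by omega)]; ring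
      refine testInterval_ne_none (b := r (i + 1)) (by omega) (by omega)
        (lt_of_lt_of_le ?_ (contrast_le_aggContrast X a c (r (i + 1)) q))
      refine lt_of_lt_of_le ?_ h1
      rw [← hD] at hq
      have h2 : 256 * σmax / η * √(logTd T d) ≤ √((δ : ℝ) ^ 3) * |D| :=
        (ENNReal.ofReal_le_ofReal_iff (by positivity)).1 (hA2.trans hq)
      have h3 : ζ < η / 2 * (√((δ : ℝ) ^ 3) * |D|) := by
        have := hζ'.trans_le (mul_le_mul_right hq (ENNReal.ofReal (η / 2)))
        rw [← ENNReal.ofReal_mul (by positivity)] at this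
        exact (ENNReal.ofReal_lt_ofReal_iff'.1 this).1
      have h4 : η * √((δ : ℝ) ^ 3) ≤ √((K : ℝ) ^ 3) / 5 := by
        rw [hη, div_mul_eq_mul_div, ← Real.sqrt_mul' _ (by positivity), ← mul_pow]
        have h5 : 0 ≤ (1 - 1 / m) / 2 * (δ : ℝ) := by
          have : 1 / m ≤ 1 := (div_le_one (by linarith)).2 hm.le
          have : 0 ≤ 1 - 1 / m := by linarith
          positivity
        gcongr
      have h5 : 256 * (σmax * √(logTd T d)) ≤ η * (√((δ : ℝ) ^ 3) * |D|) := by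
        have := mul_le_mul_of_nonneg_left h2 hη0.le
        calc _ = η * (256 * σmax / η * √(logTd T d)) := by field_simp
          _ ≤ _ := this
      have h6 := mul_le_mul_of_nonneg_right h4 (abs_nonneg D)
      have h7 : 0 ≤ η * (√((δ : ℝ) ^ 3) * |D|) := by positivity
      rw [hLdef]
      linarith
    · obtain ⟨a', c', D, hf, hD⟩ := H.exists_kink hi (by have := hsp i hi.le; omega) q
      have hcT := hrT (i + 1) hi
      obtain ⟨h1, h2, h3, h4⟩ := testInterval_eq_some hb
      have h5 : aggContrast X a c b ≤ contrast a c b fun t => X t q := ciSup_le hq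
      have h6 := cube_mul_sq_le_of_contrast_le hL0 (hX q) (s := a) (b := b) (r := r (i + 1))
        (e := c) (by omega) h1 h2 har hrc (hci.trans hcT) (x := fun t => X t q) (a := a')
        (c := c') (D := D) (fun t ht => by
          rw [Finset.mem_Icc] at ht
          rw [← hf t (by omega) (by omega) (by omega)]; ring) hLζ (h3.trans_le h5)
        ((contrast_le_aggContrast X a c _ q).trans ((h4 _ har hrc).trans h5))
      rw [← Real.mul_rpow (by positivity) hlog]
      refine mul_rpow_two_thirds_le (abs_nonneg _) (abs_nonneg _) ?_
      rw [← hD, sq_abs]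
      refine h6.trans_eq ?_
      rw [hL2]; ring
  have hall := List.forall₂_iff_get.1 (hrel.forall₂_mid H.zero)
  have hlen : N = (mid X T lam ζ).length := by simpa using hall.1
  refine ⟨hlen.symm, fun i hi q hq => ?_⟩
  have := hall.2 i (by simpa [← hlen] using hi) hi q hq
  simpa [add_comm] using this

end MID

/-- `σmax` bounds the noise levels and `m > 1` is such that the expansion step is at most `δ_T / m`;
the constants depend on nothing else. `Cstar` is the large enough constant of the assumption on the
signal, and `C₁ < C₂ * Cstar` makes the range allowed for the threshold nonempty. -/
theorem theorem2 (σmax : ℝ) (hσmax : 0 < σmax) (m : ℝ) (hm : 1 < m) :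
    ∃ Cstar C₁ C₂ C₃ C₄ : ℝ, 0 < Cstar ∧ 0 < C₁ ∧ 0 < C₂ ∧ 0 < C₃ ∧ 0 < C₄ ∧ C₁ < C₂ * Cstar ∧
      ∀ {Ω : Type*} [MeasurableSpace Ω] (P : Measure Ω) [IsProbabilityMeasure P]
        (T d N : ℕ) (r : ℕ → ℕ) (f : ℕ → Fin d → ℝ) (σ : Fin d → ℝ)
        (noise : ℕ → Ω → EuclideanSpace ℝ (Fin d)) (lam : ℕ) (ζ : ℝ),
        0 < d →
        MID.IsPiecewiseLinearSignal T d N r f →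
        (∀ q, |σ q| ≤ σmax) →
        (∀ t ∈ Finset.Icc 1 T, HasLaw (noise t) (stdGaussian (EuclideanSpace ℝ (Fin d))) P) →
        iIndepFun (fun t : Finset.Icc 1 T => noise t) P →
        0 < lam → m * lam ≤ MID.minSpacing N r →
        ENNReal.ofReal (Cstar * √(MID.logTd T d)) ≤ MID.signalStrength N r f →
        C₁ * √(MID.logTd T d) ≤ ζ →
        ENNReal.ofReal ζ < ENNReal.ofReal C₂ * MID.signalStrength N r f →
        1 - C₄ / T ≤ P.real {ω |
          MID.IsAccurate N r f (MID.observe f σ fun t => noise t ω)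
            (C₃ * MID.logTd T d ^ (1 / 3 : ℝ))
            (MID.mid (MID.observe f σ fun t => noise t ω) T lam ζ)} := by
  obtain ⟨η, hη⟩ : ∃ η, η = √(((1 - 1 / m) / 2) ^ 3) / 5 := ⟨_, rfl⟩
  have hη0 : 0 < η := by
    have : 0 < 1 - 1 / m := by
      rw [sub_pos, div_lt_one (by linarith)]; exact hm
    rw [hη]; positivity
  refine ⟨256 * σmax / η, 64 * σmax, η / 2, (3456 * σmax ^ 2) ^ (1 / 3 : ℝ), 2, by positivity,
    by positivity, by positivity, by positivity, by norm_num, ?_, ?_⟩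
  · have : η / 2 * (256 * σmax / η) = 128 * σmax := by field_simp; norm_num
    linarith
  · intro Ω _ P _ T d N r f σ noise lam ζ hd H hσ hlaw hindep hlam hmlam hA2 hζ hζ'
    have hN := H.increasing N le_rfl
    rw [H.last] at hN
    refine (MID.one_sub_le_measureReal_noiseBound (by omega) hd hσ hlaw hindep).trans
      (measureReal_mono fun ω hω => ?_)
    refine MID.isAccurate_mid hσmax hm hη hd H hlam hmlam hA2 hζ hζ' fun q => ?_
    simpa [MID.observe] using hω q
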